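/- Let $\Gamma=(\mathbb{N};\,x=y\rightarrow u=v,\,x=y)$. For $n\ge 1$, a $\Sigma_n$-sentence over $\Gamma$ is a sentence $$\exists\cdots\exists\,\forall\cdots\forall\,\exists\cdots\exists\,\cdots\;\;(C_1\wedge\dots\wedge C_s)$$ whose prefix quantifies pairwise distinct variables and consists of $n$ alternating (possibly empty) blocks of quantifiers, the first one existential, and in which every $C_i$ is a constraint of the form $x=y$ or $x=y\rightarrow u=v$ on quantified variables. The problem $\Sigma_n$-QCSP$(\mathbb{N};x=y\rightarrow u=v)$ is to decide whether a given $\Sigma_n$-sentence over $\Gamma$, written as a word over the finite alphabet $\{\exists,\forall,\wedge,=,\rightarrow,0,1\}$ with words over $\{0,1\}$ as variables, is true when the variables range over $\mathbb{N}$. **Theorem.** For every $k\ge 0$, the problem $\Sigma_{2k+1}$-QCSP$(\mathbb{N};x=y\rightarrow u=v)$ is in co-NP. That is, the set of words over this alphabet that are not true $\Sigma_{2k+1}$-sentences over $\Gamma$ is in NP: there are a finite certificate alphabet, a polynomial $p$ and a verifier running in polynomial time on a Turing machine such that a word $w$ lies in this set if and only if the verifier accepts $w$ together with some certificate of length at most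 $p(|w|)$. (The polynomials and the verifier may depend on $k$.) -/

import Mathlib

namespace EqQCSP

/-! ### NP and co-NP, over Mathlib's polynomial-time multi-stack Turing machines -/

/-- The word `x w` on which a verifier is run: the input `x` over `Γ` followed by the certificate
`w` over `Δ`, written in the disjoint union of the two alphabets. -/
def pairWord {Γ Δ : Type} (p : List Γ × List Δ) : List (Γ ⊕ Δ) :=
  p.1.map Sum.inl ++ p.2.map Sum.inr

/-- `L` is in NP: there are a finite certificate alphabet `Δ`, a verifier `V` computable by a
Turing machine in time polynomial in the length of its input `x w`, and a polynomial `p` such that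
`x ∈ L` if and only if `V` accepts `(x, w)` for some certificate `w` of length at most
`p(|x|)`. -/
def InNP {Γ : Type} [Finite Γ] (L : Language Γ) : Prop :=
  ∃ (Δ : Type) (_ : Finite Δ) (V : List Γ × List Δ → Bool) (p : Polynomial ℕ),
    Nonempty (Turing.TM2ComputableInPolyTime pairWord Computability.encodeBool V) ∧
    ∀ x : List Γ, x ∈ L ↔ ∃ w : List Δ, w.length ≤ p.eval x.length ∧ V (x, w) = true

/-- `L` is in co-NP: the set of all words over `Γ` that are not in `L` is in NP. -/
def InCoNP {Γ : Type} [Finite Γ] (L : Language Γ) : Prop :=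
  InNP ({x : List Γ | x ∉ L} : Language Γ)

/-! ### Quantified conjunctive sentences over `(ℕ; x = y → u = v, x = y)` -/

/-- A variable is named by a word over `{0, 1}`. -/
abbrev Var : Type := List Bool

/-- Quantifiers. -/
inductive Quant
  | ex
  | all

/-- The other quantifier. -/
def Quant.dual : Quant → Quant
  | ex => all
  | all => ex

/-- A constraint `x = y` or `x = y → u = v`. -/
inductive Constraint
  | eq (x y : Var)
  | imp (x y u v : Var)

/-- The variables of a constraint. -/
def Constraint.vars : Constraint → List Var
  | eq x y => [x, y]
  | imp x y u v => [x, y, u, v]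

/-- Satisfaction of a constraint by an assignment of natural numbers to the variables. -/
def Constraint.Sat (ρ : Var → ℕ) : Constraint → Prop
  | eq x y => ρ x = ρ y
  | imp x y u v => ρ x = ρ y → ρ u = ρ v

/-- A prenex formula `Q₁ x₁ … Qₙ xₙ (C₁ ∧ … ∧ Cₛ)`. -/
structure Formula where
  /-- the quantifiers with their variables, outermost first -/
  quants : List (Quant × Var)
  /-- the constraints `C₁, …, Cₛ` -/
  matrix : List Constraint

/-- The formula is a sentence: the quantified variables are distinct, and all variables of the
constraints are quantified. -/
def Formula.IsSentence (φ : Formula) : Prop :=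
  (φ.quants.map Prod.snd).Nodup ∧
    ∀ C ∈ φ.matrix, ∀ x ∈ C.vars, x ∈ φ.quants.map Prod.snd

/-- The list of quantifiers splits into `n` consecutive (possibly empty) blocks of equal
quantifiers, of alternating kinds, the first block being of kind `q`. -/
def IsBlocks : Quant → ℕ → List Quant → Prop
  | _, 0, l => l = []
  | q, n + 1, l => ∃ (m : ℕ) (l' : List Quant), l = List.replicate m q ++ l' ∧ IsBlocks q.dual n l'

/-- The formula is `Σₙ`: its prefix has the shape `∃…∃ ∀…∀ ∃…∃ …` with `n` blocks. -/
def Formula.IsSigma (n : ℕ) (φ : Formula) : Prop :=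
  IsBlocks Quant.ex n (φ.quants.map Prod.fst)

/-- Truth over `ℕ` of a quantified conjunction of constraints under an assignment. -/
def Holds (M : List Constraint) : List (Quant × Var) → (Var → ℕ) → Prop
  | [], ρ => ∀ C ∈ M, C.Sat ρ
  | (Quant.ex, x) :: Q, ρ => ∃ a : ℕ, Holds M Q (Function.update ρ x a)
  | (Quant.all, x) :: Q, ρ => ∀ a : ℕ, Holds M Q (Function.update ρ x a)

/-- Truth of a formula over `ℕ`; for a sentence the initial assignment is irrelevant. -/
def Formula.IsTrue (φ : Formula) : Prop :=
  Holds φ.matrix φ.quants (fun _ => 0)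

/-! ### Sentences as words -/

/-- The seven symbols `∃`, `∀`, `∧`, `=`, `→`, `0`, `1` in which sentences are written. -/
inductive Sym
  | ex
  | all
  | and
  | eq
  | imp
  | bit (b : Bool)
  deriving DecidableEq, Fintype

/-- A variable is written as its name. -/
def Var.encode (x : Var) : List Sym := x.map Sym.bit

/-- The symbol of a quantifier. -/
def Quant.sym : Quant → Sym
  | ex => Sym.ex
  | all => Sym.all

/-- The words `x=y` and `x=y→u=v`. -/
def Constraint.encode : Constraint → List Sym
  | eq x y => Var.encode x ++ Sym.eq :: Var.encode y
  | imp x y u v =>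
      Var.encode x ++ Sym.eq :: Var.encode y ++
        Sym.imp :: (Var.encode u ++ Sym.eq :: Var.encode v)

/-- The word `Q₁x₁…Qₙxₙ∧C₁…∧Cₛ`: each quantifier is followed by its variable, and each constraint
is preceded by `∧`. -/
def Formula.encode (φ : Formula) : List Sym :=
  φ.quants.flatMap (fun p => p.1.sym :: Var.encode p.2) ++
    φ.matrix.flatMap (fun C => Sym.and :: C.encode)

/-- `Σₙ`-QCSP(ℕ; x = y → u = v), with atoms `x = y` allowed: the set of all words that are the
encoding of a true `Σₙ`-sentence. -/
def sigmaQCSP (n : ℕ) : Language Sym :=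
  {w | ∃ φ : Formula, φ.IsSentence ∧ φ.IsSigma n ∧ φ.IsTrue ∧ φ.encode = w}

end EqQCSP

/-! Falsity of a sentence is captured by a calculus of forced equalities. A move of the universal
player matters only through the earlier variable whose value it repeats, if any; recording this for
all universal variables gives a pattern `σ`, with `σ i = i` for a fresh value. Under a pattern,
equalities follow from equivalence reasoning, from the moves in `σ`, from the constraints, and from
a transfer rule: an equality of two quantified variables passes between patterns that agree on all
relevant universal variables. A contradiction is an equality between a fresh universal variable and
an earlier variable.

The calculus is sound (`Represents.not_holds`): under a fixed existential strategy, the values of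
two variables depend only on the universal moves up to them. It is complete
(`Represents.holds_of_consistent`): the constraints are Horn, so without a contradiction the
existential player wins by making values equal only where equality is derivable, and playing fresh
values otherwise.

There are too many patterns to list in a certificate, but with at most `k` universal blocks few
suffice. The transfer rule sees a pattern only up to a level `l ≤ k`, the number of universal blocks
begun. Starting from the pattern `σ₀` of a contradiction, for `l = 0, …, k` and for each pattern so
far and each pair of tokens, a pattern is added that agrees with the given one up to level `l` and
has a derivation of least height for this pair. This gives at most `(1 + n²) ^ (k + 1)` patterns.
Every transfer in a shortest derivation can be redirected to one of them without increasing the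
height of its premise (`exists_mem_pats`). Only the order of heights matters, so they can be
compressed to polynomially bounded ranks (`exists_refut`). A certificate lists patterns and ranks;
checking it means checking that each positive rank is justified by smaller ones.

Well-formedness of the input and correctness of the certificate are bounded-quantifier statements
about positions of a word. Their characteristic functions are built by bounded sums, and
`BSum.computes` evaluates these in polynomial time by structured stack programs with unary
registers, which compile to Turing machines. Words that are not sentences of the required form are
accepted by the same check, with an empty certificate. -/

namespace EqQCSP

open Turing

/-! ### Structured stack programs and their compilation to multi-stack Turing machines -/

section Prog

variable {K : Type} [DecidableEq K] {Γ : K → Type}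

/-- Structured programs over a family of stacks. -/
inductive Prog (Γ : K → Type) : Type
  | skip
  | push (k : K) (a : Γ k)
  | seq (p q : Prog Γ)
  /-- pop the stack `k` and branch on the symbol found, if any -/
  | casePop (k : K) (p : Prog Γ) (f : Γ k → Prog Γ)
  /-- as long as the stack `k` is nonempty, pop it and run the program chosen by the symbol -/
  | whilePop (k : K) (f : Γ k → Prog Γ)

/-- `Exec p S S' t`: started on the stacks `S`, the program `p` ends with the stacks `S'` after `t`
steps. -/
inductive Exec : Prog Γ → (∀ k, List (Γ k)) → (∀ k, List (Γ k)) → ℕ → Prop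
  | skip (S) : Exec .skip S S 0
  | push (k a S) : Exec (.push k a) S (Function.update S k (a :: S k)) 1
  | seq {p q S S' S'' t t'} : Exec p S S' t → Exec q S' S'' t' → Exec (.seq p q) S S'' (t + t')
  | case_nil {k p f S S' t} : S k = [] → Exec p S S' t → Exec (.casePop k p f) S S' (1 + t)
  | case_cons {k p f S S' t a l} : S k = a :: l → Exec (f a) (Function.update S k l) S' t →
      Exec (.casePop k p f) S S' (1 + t)
  | while_nil {k f S} : S k = [] → Exec (.whilePop k f) S S 1
  | while_cons {k f S S' S'' t t' a l} : S k = a :: l → Exec (f a) (Function.update S k l) S' t →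
      Exec (.whilePop k f) S' S'' t' → Exec (.whilePop k f) S S'' (1 + t + t')

/-- The labels of the machine that executes a program. -/
def Prog.Lbl : Prog Γ → Type
  | .skip => Empty
  | .push _ _ => Unit
  | .seq p q => p.Lbl ⊕ q.Lbl
  | .casePop _ p f => Unit ⊕ (p.Lbl ⊕ (Σ a, (f a).Lbl))
  | .whilePop _ f => Unit ⊕ (Σ a, (f a).Lbl)

noncomputable instance Prog.fintypeLbl [∀ k, Fintype (Γ k)] : ∀ p : Prog Γ, Fintype p.Lbl
  | .skip => inferInstanceAs (Fintype Empty)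
  | .push _ _ => inferInstanceAs (Fintype Unit)
  | .seq p q =>
    haveI := fintypeLbl p
    haveI := fintypeLbl q
    inferInstanceAs (Fintype (p.Lbl ⊕ q.Lbl))
  | .casePop _ p f =>
    haveI := fintypeLbl p
    haveI := fun a => fintypeLbl (f a)
    inferInstanceAs (Fintype (Unit ⊕ (p.Lbl ⊕ (Σ a, (f a).Lbl))))
  | .whilePop _ f =>
    haveI := fun a => fintypeLbl (f a)
    inferInstanceAs (Fintype (Unit ⊕ (Σ a, (f a).Lbl)))

/-- The label at which the execution of a program starts. -/
def Prog.entry {L : Type} : (p : Prog Γ) → L → (p.Lbl → L) → L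
  | .skip, ex, _ => ex
  | .push _ _, _, em => em ()
  | .seq p q, ex, em => p.entry (q.entry ex (fun l => em (.inr l))) (fun l => em (.inl l))
  | .casePop _ _ _, _, em => em (Sum.inl ())
  | .whilePop _ _, _, em => em (Sum.inl ())

/-- Go to a label that depends on the symbol last popped. -/
def gotoPopped {L : Type} (k : K) (l₀ : L) (l : Γ k → L) :
    TM2.Stmt Γ L (Option (Σ k, Γ k)) :=
  .goto fun v => match v with
    | none => l₀
    -- The inequality branch is a dummy: the jump is only used directly after a pop of the stack
    -- `k`.
    | some ⟨k', a⟩ => if h : k' = k then l (h ▸ a) else l₀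

/-- The statements of the machine that executes a program. -/
def Prog.code {L : Type} : (p : Prog Γ) → L → (p.Lbl → L) → p.Lbl →
    TM2.Stmt Γ L (Option (Σ k, Γ k))
  | .skip, _, _, l => l.elim
  | .push k a, ex, _, _ => .push k (fun _ => a) (.goto fun _ => ex)
  | .seq p q, ex, em, .inl l => p.code (q.entry ex (fun l => em (.inr l))) (fun l => em (.inl l)) l
  | .seq _ q, ex, em, .inr l => q.code ex (fun l => em (.inr l)) l
  | .casePop k p f, ex, em, .inl _ =>
    .pop k (fun _ o => o.map (Sigma.mk k)) (gotoPopped k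
      (p.entry ex (fun l => em (.inr (.inl l))))
      (fun a => (f a).entry ex (fun l => em (.inr (.inr ⟨a, l⟩)))))
  | .casePop _ p _, ex, em, .inr (.inl l) => p.code ex (fun l => em (.inr (.inl l))) l
  | .casePop _ _ f, ex, em, .inr (.inr ⟨a, l⟩) =>
    (f a).code ex (fun l => em (.inr (.inr ⟨a, l⟩))) l
  | .whilePop k f, ex, em, .inl _ =>
    .pop k (fun _ o => o.map (Sigma.mk k)) (gotoPopped k ex
      (fun a => (f a).entry (em (Sum.inl ())) (fun l => em (.inr ⟨a, l⟩))))
  | .whilePop _ f, _, em, .inr ⟨a, l⟩ =>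
    (f a).code (em (Sum.inl ())) (fun l => em (.inr ⟨a, l⟩)) l

/-- `n` steps of a machine lead from the first configuration to the second. -/
def StepsTo {L σ : Type} (M : L → TM2.Stmt Γ L σ) (n : ℕ) (c c' : TM2.Cfg Γ L σ) : Prop :=
  (flip bind (TM2.step M))^[n] (some c) = some c'

theorem StepsTo.trans {L σ : Type} {M : L → TM2.Stmt Γ L σ} {n n' : ℕ} {c c' c'' : TM2.Cfg Γ L σ}
    (h : StepsTo M n c c') (h' : StepsTo M n' c' c'') : StepsTo M (n + n') c c'' := by
  unfold StepsTo at *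
  rw [Nat.add_comm, Function.iterate_add_apply, h, h']

theorem StepsTo.one {L σ : Type} {M : L → TM2.Stmt Γ L σ} {c c' : TM2.Cfg Γ L σ}
    (h : TM2.step M c = some c') : StepsTo M 1 c c' := h

/-- Correctness of the compilation, by induction on the execution. The exit label and the embedding
of labels are arbitrary because a subprogram runs inside a larger machine and exits into its
continuation. The internal memory may be arbitrary since every pop overwrites it before it is read.
-/
theorem Exec.stepsTo {L : Type} (M : L → TM2.Stmt Γ L (Option (Σ k, Γ k))) {p : Prog Γ}
    {S S' : ∀ k, List (Γ k)} {t : ℕ} (h : Exec p S S' t) (ex : L) (em : p.Lbl → L)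
    (hM : ∀ l, M (em l) = p.code ex em l) (v : Option (Σ k, Γ k)) :
    ∃ v', StepsTo M t ⟨some (p.entry ex em), v, S⟩ ⟨some ex, v', S'⟩ := by
  induction h generalizing v ex with
  | skip S => exact ⟨v, rfl⟩
  | push k a S =>
    refine ⟨v, .one ?_⟩
    have hM' := hM ()
    simp [Prog.entry, TM2.step, hM', Prog.code]
  | seq h₁ h₂ ih₁ ih₂ =>
    rename_i p q _ _ _ _ _
    obtain ⟨v₁, h₁⟩ := ih₁ (q.entry ex (fun l => em (.inr l))) (fun l => em (.inl l)) (fun l => hM (.inl l)) v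
    obtain ⟨v₂, h₂⟩ := ih₂ ex (fun l => em (.inr l)) (fun l => hM (.inr l)) v₁
    exact ⟨v₂, h₁.trans h₂⟩
  | case_nil hS h ih =>
    rename_i k p f S _ _
    obtain ⟨v', h'⟩ := ih ex (fun l => em (.inr (.inl l))) (fun l => hM (.inr (.inl l))) none
    refine ⟨v', .trans (.one ?_) h'⟩
    have : Function.update S k [] = S := by rw [← hS, Function.update_eq_self]
    have hM' := hM (.inl ())
    simp [Prog.entry, TM2.step, hM', Prog.code, gotoPopped, hS, this]
  | case_cons hS h ih =>
    rename_i k p f S _ _ a l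
    obtain ⟨v', h'⟩ := ih ex (fun l => em (.inr (.inr ⟨a, l⟩)))
      (fun l => hM (.inr (.inr ⟨a, l⟩))) (some ⟨k, a⟩)
    refine ⟨v', .trans (.one ?_) h'⟩
    have hM' := hM (.inl ())
    simp [Prog.entry, TM2.step, hM', Prog.code, gotoPopped, hS]
  | while_nil hS =>
    rename_i k f S
    refine ⟨none, .one ?_⟩
    have : Function.update S k [] = S := by rw [← hS, Function.update_eq_self]
    have hM' := hM (.inl ())
    simp [Prog.entry, TM2.step, hM', Prog.code, gotoPopped, hS, this]
  | while_cons hS h₁ h₂ ih₁ ih₂ =>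
    rename_i k f S _ _ _ _ a l
    obtain ⟨v₁, h₁⟩ := ih₁ (em (Sum.inl ())) (fun l => em (.inr ⟨a, l⟩))
      (fun l => hM (.inr ⟨a, l⟩)) (some ⟨k, a⟩)
    obtain ⟨v₂, h₂⟩ := ih₂ ex em hM v₁
    refine ⟨v₂, .trans (.trans (.one ?_) h₁) h₂⟩
    have hM' := hM (.inl ())
    simp [Prog.entry, TM2.step, hM', Prog.code, gotoPopped, hS]

/-- `p` leads from `S` to `S'` in at most `t` steps. -/
def Runs (p : Prog Γ) (S S' : ∀ k, List (Γ k)) (t : ℕ) : Prop :=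
  ∃ t' ≤ t, Exec p S S' t'

namespace Runs

variable {p q : Prog Γ} {S S' S'' : ∀ k, List (Γ k)} {t t' : ℕ} {k : K} {f : Γ k → Prog Γ}

theorem mono (h : Runs p S S' t) (ht : t ≤ t') : Runs p S S' t' :=
  let ⟨u, hu, h⟩ := h
  ⟨u, hu.trans ht, h⟩

theorem skip (S : ∀ k, List (Γ k)) : Runs .skip S S 0 := ⟨0, le_rfl, .skip S⟩

theorem push (a : Γ k) (h : Function.update S k (a :: S k) = S') : Runs (.push k a) S S' 1 :=
  ⟨1, le_rfl, h ▸ .push k a S⟩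

theorem seq (h : Runs p S S' t) (h' : Runs q S' S'' t') : Runs (.seq p q) S S'' (t + t') :=
  let ⟨_, hu, h⟩ := h
  let ⟨_, hu', h'⟩ := h'
  ⟨_, Nat.add_le_add hu hu', .seq h h'⟩

theorem case_nil (hS : S k = []) (h : Runs p S S' t) : Runs (.casePop k p f) S S' (1 + t) :=
  let ⟨_, hu, h⟩ := h
  ⟨_, Nat.add_le_add le_rfl hu, .case_nil hS h⟩

theorem case_cons {a : Γ k} {l : List (Γ k)} (hS : S k = a :: l)
    (h : Runs (f a) (Function.update S k l) S' t) : Runs (.casePop k p f) S S' (1 + t) :=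
  let ⟨_, hu, h⟩ := h
  ⟨_, Nat.add_le_add le_rfl hu, .case_cons hS h⟩

/-- A loop that runs through the states `X 0, …, X n`. -/
theorem while_iter (X : ℕ → ∀ k, List (Γ k)) (n : ℕ)
    (hX : ∀ i < n, ∃ a l, X i k = a :: l ∧ Runs (f a) (Function.update (X i) k l) (X (i + 1)) t)
    (hn : X n k = []) : Runs (.whilePop k f) (X 0) (X n) (n * (1 + t) + 1) := by
  induction n generalizing X with
  | zero => exact ⟨1, by omega, .while_nil hn⟩
  | succ n ih =>
    obtain ⟨a, l, hS, u, hu, h⟩ := hX 0 (Nat.succ_pos n)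
    obtain ⟨u', hu', h'⟩ := ih (fun i => X (i + 1)) (fun i hi => hX (i + 1) (by omega)) hn
    refine ⟨1 + u + u', ?_, .while_cons hS h h'⟩
    have : (n + 1) * (1 + t) = n * (1 + t) + (1 + t) := by ring
    omega

end Runs

/-- The machine that executes a program. -/
noncomputable def Prog.machine [Fintype K] [∀ k, Fintype (Γ k)] (p : Prog Γ) (k₀ k₁ : K) :
    FinTM2 where
  k₀ := k₀
  k₁ := k₁
  Γ := Γ
  Λ := Option p.Lbl
  main := p.entry none some
  σ := Option (Σ k, Γ k)
  initialState := none
  m := fun l => match l with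
    -- The exit label costs one more step, which resets the memory: a halting configuration must
    -- carry the initial state.
    | none => .load (fun _ => none) .halt
    | some l => p.code none some l

end Prog

end EqQCSP

namespace EqQCSP

open Turing

/-! ### Functions built from bounded sums are computable in polynomial time -/

/-- Extension of an environment by a new variable with index `0`. -/
def consEnv {α : Type} (i : α) (v : ℕ → α) : ℕ → α
  | 0 => i
  | k + 1 => v k

/-- The functions of a word and of finitely many numbers that are built from variables, the length
of the word and tests for symbols of the word by addition, truncated subtraction and bounded sums. -/
inductive BSum {A : Type} : (List A → (ℕ → ℕ) → ℕ) → Prop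
  | var (i : ℕ) : BSum fun _ v => v i
  | one : BSum fun _ _ => 1
  | len : BSum fun w _ => w.length
  | sym (a : A) {f} : BSum f → BSum fun w v => open Classical in if w[f w v]? = some a then 1 else 0
  | add {f g} : BSum f → BSum g → BSum fun w v => f w v + g w v
  | sub {f g} : BSum f → BSum g → BSum fun w v => f w v - g w v
  | sum {f g} : BSum f → BSum g → BSum fun w v => ∑ i ∈ Finset.range (f w v), g w (consEnv i v)

theorem consEnv_le {i N : ℕ} {v : ℕ → ℕ} (hi : i ≤ N) (hv : ∀ k, v k ≤ N) (k : ℕ) :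
    consEnv i v k ≤ N := by
  cases k with
  | zero => exact hi
  | succ k => exact hv k

/-- Values must be polynomially bounded since registers are unary. In a bounded sum the index may
exceed the old bound `N` on the variables, but not `N` plus the bound for the range; hence the
composition of polynomials. -/
theorem BSum.bounded {A : Type} {f : List A → (ℕ → ℕ) → ℕ} (hf : BSum f) :
    ∃ q : Polynomial ℕ, ∀ w v N, w.length ≤ N → (∀ k, v k ≤ N) → f w v ≤ q.eval N := by
  induction hf with
  | var i => exact ⟨.X, fun w v N _ hv => by simpa using hv i⟩
  | one => exact ⟨1, fun w v N _ hv => by simp⟩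
  | len => exact ⟨.X, fun w v N h _ => by simpa using h⟩
  | sym a _ _ => exact ⟨1, fun w v N _ hv => by simp only [Polynomial.eval_one]; split_ifs <;> simp⟩
  | add _ _ ihf ihg =>
    obtain ⟨p, hp⟩ := ihf
    obtain ⟨q, hq⟩ := ihg
    refine ⟨p + q, fun w v N hw hv => ?_⟩
    rw [Polynomial.eval_add]
    exact Nat.add_le_add (hp w v N hw hv) (hq w v N hw hv)
  | sub _ _ ihf ihg =>
    obtain ⟨p, hp⟩ := ihf
    exact ⟨p, fun w v N hw hv => (Nat.sub_le _ _).trans (hp w v N hw hv)⟩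
  | sum _ _ ihf ihg =>
    rename_i f g _ _
    obtain ⟨p, hp⟩ := ihf
    obtain ⟨q, hq⟩ := ihg
    refine ⟨p * q.comp (.X + p), fun w v N hw hv => ?_⟩
    simp only [Polynomial.eval_mul, Polynomial.eval_comp, Polynomial.eval_add, Polynomial.eval_X]
    have h1 : ∀ i ∈ Finset.range (f w v), g w (consEnv i v) ≤ q.eval (N + p.eval N) := by
      intro i hi
      have := hp w v N hw hv
      have := Finset.mem_range.1 hi
      exact hq w _ _ (by omega) (consEnv_le (by omega) fun k => (hv k).trans (by omega))
    refine (Finset.sum_le_card_nsmul _ _ _ h1).trans ?_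
    rw [Finset.card_range, smul_eq_mul]
    exact Nat.mul_le_mul_right _ (hp w v N hw hv)

/-- The stacks of the evaluating machine: input, auxiliary stack, output, and `m` unary registers. -/
inductive Stk (m : ℕ) : Type
  | inp
  | aux
  | out
  | reg (i : Fin m)
  deriving DecidableEq, Fintype

/-- The stack alphabets of the evaluating machine. -/
def StkAlpha (A : Type) {m : ℕ} : Stk m → Type
  | .inp => A
  | .aux => A
  | .out => Bool
  | .reg _ => Unit

noncomputable instance (A : Type) [Fintype A] {m : ℕ} : ∀ k : Stk m, Fintype (StkAlpha A k)
  | .inp => inferInstanceAs (Fintype A)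
  | .aux => inferInstanceAs (Fintype A)
  | .out => inferInstanceAs (Fintype Bool)
  | .reg _ => inferInstanceAs (Fintype Unit)

/-! ### Programs on unary registers -/

section Machine

variable {A : Type} {m : ℕ}

/-- The stacks with given contents of input stack, auxiliary stack and registers. -/
def stks (x y : List A) (r : Fin m → ℕ) : ∀ k : Stk m, List (StkAlpha A k)
  | .inp => x
  | .aux => y
  | .out => []
  | .reg i => List.replicate (r i) ()

theorem update_inp (x x' y : List A) (r : Fin m → ℕ) :
    Function.update (stks x y r) .inp x' = stks x' y r := by
  funext k; cases k <;> rfl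

theorem update_aux (x y y' : List A) (r : Fin m → ℕ) :
    Function.update (stks x y r) .aux y' = stks x y' r := by
  funext k; cases k <;> rfl

theorem update_reg (x y : List A) (r : Fin m → ℕ) (i : Fin m) (n : ℕ) :
    Function.update (stks x y r) (.reg i) (List.replicate n ()) =
      stks x y (Function.update r i n) := by
  funext k
  cases k with
  | reg j =>
    by_cases h : j = i
    · subst h; simp [stks]
    · rw [Function.update_of_ne (by simpa using h)]
      simp [stks, h]
  | _ => rfl

abbrev MProg (A : Type) (m : ℕ) := Prog (StkAlpha A (m := m))

/-- Increment a register. -/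
def incr (i : Fin m) : MProg A m := .push (.reg i) ()

theorem runs_incr (i : Fin m) (x y : List A) (r r' : Fin m → ℕ)
    (h : r' = Function.update r i (r i + 1)) :
    Runs (incr i) (stks x y r) (stks x y r') 1 :=
  .push _ (by rw [h, ← update_reg]; rfl)

theorem runs_push_inp (a : A) (x y : List A) (r : Fin m → ℕ) :
    Runs (.push .inp a) (stks x y r) (stks (a :: x) y r) 1 :=
  .push _ (update_inp _ _ _ _)

theorem runs_push_aux (a : A) (x y : List A) (r : Fin m → ℕ) :
    Runs (.push .aux a) (stks x y r) (stks x (a :: y) r) 1 :=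
  .push _ (update_aux _ _ _ _)

/-- Repeat `p` as often as the register `i` says, counting the register down. -/
def loop (i : Fin m) (p : MProg A m) : MProg A m := .whilePop (.reg i) fun _ => p

/-- Before pass `j` the counter holds `n - j`. The loop decrements it before running the body, so
the body starts with `n - (j + 1)` in it. -/
theorem runs_loop {p : MProg A m} {t : ℕ} (i : Fin m) (n : ℕ) (x y : ℕ → List A)
    (r : ℕ → Fin m → ℕ) (hr : ∀ j ≤ n, r j i = n - j)
    (h : ∀ j < n, Runs p (stks (x j) (y j) (Function.update (r j) i (n - (j + 1))))
      (stks (x (j + 1)) (y (j + 1)) (r (j + 1))) t) :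
    Runs (loop i p) (stks (x 0) (y 0) (r 0)) (stks (x n) (y n) (r n)) (n * (1 + t) + 1) := by
  refine Runs.while_iter (fun j => stks (x j) (y j) (r j)) n (fun j hj => ?_) ?_
  · refine ⟨(), List.replicate (n - (j + 1)) (), ?_, ?_⟩
    · show List.replicate (r j i) () = _
      rw [hr j hj.le, show n - j = (n - (j + 1)) + 1 by omega]
      rfl
    · rw [update_reg]
      exact h j hj
  · show List.replicate (r n i) () = _
    rw [hr n le_rfl, Nat.sub_self]; rfl

/-- Move the content of a register to another one. -/
theorem runs_move {i k : Fin m} (hik : i ≠ k) (x y : List A) (r r' : Fin m → ℕ)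
    (h : r' = Function.update (Function.update r k (r k + r i)) i 0) :
    Runs (loop i (incr k)) (stks x y r) (stks x y r') (r i * 2 + 1) := by
  have := runs_loop (p := incr k) (t := 1) i (r i) (fun _ => x) (fun _ => y)
    (fun j => Function.update (Function.update r k (r k + j)) i (r i - j))
    (fun j _ => by simp) (fun j _ => runs_incr _ _ _ _ _ (by
      funext l; simp only [Function.update_apply]; split_ifs <;> (simp_all; try omega)))
  rw [h]
  simpa using this

theorem runs_clear (i : Fin m) (x y : List A) (r r' : Fin m → ℕ) (h : r' = Function.update r i 0) :
    Runs (loop i .skip) (stks x y r) (stks x y r') (r i * 1 + 1) := by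
  have := runs_loop (p := .skip) (t := 0) i (r i) (fun _ => x) (fun _ => y)
    (fun j => Function.update r i (r i - j))
    (fun j _ => by simp) (fun j _ => by simpa using Runs.skip _)
  rw [h]
  simpa using this

/-- Reading a register by a loop empties it. The value is therefore doubled into `k` and `l`, and
`l` is used to restore `i`. -/
theorem runs_copy {i k l : Fin m} (hik : i ≠ k) (hil : i ≠ l) (hkl : k ≠ l) (x y : List A)
    (r r' : Fin m → ℕ) (hk : r k = 0) (hl : r l = 0) (h : r' = Function.update r k (r i)) :
    Runs (.seq (loop i (.seq (incr k) (incr l))) (loop l (incr i))) (stks x y r) (stks x y r')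
      ((r i * 3 + 1) + (r i * 2 + 1)) := by
  have h1 := runs_loop (p := .seq (incr k) (incr l)) (t := 1 + 1) i (r i) (fun _ => x) (fun _ => y)
    (fun j => Function.update (Function.update (Function.update r k j) l j) i (r i - j))
    (fun j _ => by simp) (fun j _ => (runs_incr _ _ _ _ _ rfl).seq (runs_incr _ _ _ _ _ (by
      funext l; simp only [Function.update_apply]; split_ifs <;> simp_all)))
  have h2 := runs_move (i := l) (k := i) hil.symm x y
    (Function.update (Function.update (Function.update r k (r i)) l (r i)) i 0) r' (by
      rw [h]; funext l; simp only [Function.update_apply]; split_ifs <;> simp_all)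
  have e : Function.update (Function.update (Function.update r k 0) l 0) i (r i - 0) = r := by
    funext l; simp only [Function.update_apply]; split_ifs <;> simp_all
  rw [e] at h1
  simp only [Nat.sub_self] at h1
  refine (h1.seq h2).mono ?_
  simp [hil.symm]

end Machine

end EqQCSP

namespace EqQCSP

open Turing

/-! ### Moving along the input word and reading its symbols -/

section Walk

variable {A : Type} {m : ℕ}

/-- Move one symbol from the input stack to the auxiliary stack. -/
def stepRight : MProg A m := .casePop .inp .skip fun x => .push .aux x

/-- Move one symbol from the auxiliary stack to the input stack. -/
def stepLeft : MProg A m := .casePop .aux .skip fun x => .push .inp x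

/-- The stacks with the word `w` divided at position `j` over input and auxiliary stack. -/
def split (w : List A) (j : ℕ) (r : Fin m → ℕ) : ∀ k : Stk m, List (StkAlpha A k) :=
  stks (w.drop j) (w.take j).reverse r

/-- Beyond the end of the word all positions give the same stacks, so steps to the right may
overshoot. -/
theorem split_of_le (w : List A) {i j : ℕ} (r : Fin m → ℕ) (hi : w.length ≤ i)
    (hj : w.length ≤ j) : split w i r = split w j r := by
  simp [split, List.drop_eq_nil_of_le, List.take_of_length_le, hi, hj]

theorem split_eq_cons_left (w : List A) {j : ℕ} (h : j < w.length) (r : Fin m → ℕ) :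
    split w j r = stks (w[j] :: w.drop (j + 1)) (w.take j).reverse r := by
  unfold split
  rw [← List.drop_eq_getElem_cons h]

theorem split_succ_eq_cons_right (w : List A) {j : ℕ} (h : j < w.length) (r : Fin m → ℕ) :
    split w (j + 1) r = stks (w.drop (j + 1)) (w[j] :: (w.take j).reverse) r := by
  unfold split
  rw [List.take_add_one, List.getElem?_eq_getElem h, List.reverse_append]
  rfl

theorem runs_case_inp {p : MProg A m} {f : A → MProg A m} {a : A} {x y : List A} {r : Fin m → ℕ}
    {S' : ∀ k : Stk m, List (StkAlpha A k)} {t : ℕ} (h : Runs (f a) (stks x y r) S' t) :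
    Runs (.casePop (Γ := StkAlpha A) .inp p f) (stks (a :: x) y r) S' (1 + t) := by
  refine Runs.case_cons (Γ := StkAlpha A) (k := Stk.inp) (a := a) (l := x) rfl ?_
  rwa [update_inp]

theorem runs_case_aux {p : MProg A m} {f : A → MProg A m} {a : A} {x y : List A} {r : Fin m → ℕ}
    {S' : ∀ k : Stk m, List (StkAlpha A k)} {t : ℕ} (h : Runs (f a) (stks x y r) S' t) :
    Runs (.casePop (Γ := StkAlpha A) .aux p f) (stks x (a :: y) r) S' (1 + t) := by
  refine Runs.case_cons (Γ := StkAlpha A) (k := Stk.aux) (a := a) (l := y) rfl ?_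
  rwa [update_aux]

theorem runs_case_inp_nil {p : MProg A m} {f : A → MProg A m} {y : List A} {r : Fin m → ℕ}
    {S' : ∀ k : Stk m, List (StkAlpha A k)} {t : ℕ} (h : Runs p (stks [] y r) S' t) :
    Runs (.casePop (Γ := StkAlpha A) .inp p f) (stks [] y r) S' (1 + t) :=
  Runs.case_nil (Γ := StkAlpha A) (k := Stk.inp) rfl h

theorem runs_case_aux_nil {p : MProg A m} {f : A → MProg A m} {x : List A} {r : Fin m → ℕ}
    {S' : ∀ k : Stk m, List (StkAlpha A k)} {t : ℕ} (h : Runs p (stks x [] r) S' t) :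
    Runs (.casePop (Γ := StkAlpha A) .aux p f) (stks x [] r) S' (1 + t) :=
  Runs.case_nil (Γ := StkAlpha A) (k := Stk.aux) rfl h

theorem runs_while_inp {f : A → MProg A m} {t : ℕ} (n : ℕ) (x y : ℕ → List A)
    (r : ℕ → Fin m → ℕ) (hx : ∀ j < n, ∃ a l, x j = a :: l ∧
      Runs (f a) (stks l (y j) (r j)) (stks (x (j + 1)) (y (j + 1)) (r (j + 1))) t)
    (hn : x n = []) :
    Runs (.whilePop (Γ := StkAlpha A) .inp f) (stks (x 0) (y 0) (r 0)) (stks (x n) (y n) (r n))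
      (n * (1 + t) + 1) := by
  refine Runs.while_iter (Γ := StkAlpha A) (k := Stk.inp) (fun j => stks (x j) (y j) (r j)) n
    (fun j hj => ?_) hn
  obtain ⟨a, l, h, h'⟩ := hx j hj
  exact ⟨a, l, h, by rwa [update_inp]⟩

theorem runs_while_aux {f : A → MProg A m} {t : ℕ} (n : ℕ) (x y : ℕ → List A)
    (r : ℕ → Fin m → ℕ) (hx : ∀ j < n, ∃ a l, y j = a :: l ∧
      Runs (f a) (stks (x j) l (r j)) (stks (x (j + 1)) (y (j + 1)) (r (j + 1))) t)
    (hn : y n = []) :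
    Runs (.whilePop (Γ := StkAlpha A) .aux f) (stks (x 0) (y 0) (r 0)) (stks (x n) (y n) (r n))
      (n * (1 + t) + 1) := by
  refine Runs.while_iter (Γ := StkAlpha A) (k := Stk.aux) (fun j => stks (x j) (y j) (r j)) n
    (fun j hj => ?_) hn
  obtain ⟨a, l, h, h'⟩ := hx j hj
  exact ⟨a, l, h, by rwa [update_aux]⟩

theorem runs_stepRight (w : List A) (j : ℕ) (r : Fin m → ℕ) :
    Runs stepRight (split w j r) (split w (j + 1) r) 2 := by
  by_cases h : j < w.length
  · rw [split_eq_cons_left w h, split_succ_eq_cons_right w h]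
    exact runs_case_inp (runs_push_aux _ _ _ _)
  · rw [split_of_le w r (i := j + 1) (j := j) (by omega) (by omega)]
    unfold split
    rw [List.drop_eq_nil_of_le (Nat.le_of_not_lt h)]
    exact (runs_case_inp_nil (Runs.skip _)).mono (by omega)

theorem runs_stepLeft (w : List A) (j : ℕ) (hj : j ≤ w.length) (r : Fin m → ℕ) :
    Runs stepLeft (split w j r) (split w (j - 1) r) 2 := by
  cases j with
  | zero => exact (runs_case_aux_nil (Runs.skip _)).mono (by omega)
  | succ j =>
    rw [Nat.add_sub_cancel, split_eq_cons_left w hj, split_succ_eq_cons_right w hj]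
    exact runs_case_aux (runs_push_inp _ _ _ _)

/-- Set the register `D` to the length of the word. -/
def lenProg (D : Fin m) : MProg A m :=
  .seq (.whilePop .inp fun x => .seq (.push .aux x) (incr D)) (.whilePop .aux fun x => .push .inp x)

theorem runs_lenProg (D : Fin m) (w : List A) (r : Fin m → ℕ) (hD : r D = 0) :
    Runs (lenProg D) (stks w [] r) (stks w [] (Function.update r D w.length))
      ((w.length * 3 + 1) + (w.length * 2 + 1)) := by
  have h1 := runs_while_inp (t := 2) (f := fun x => .seq (.push .aux x) (incr D)) w.length
    (fun j => w.drop j) (fun j => (w.take j).reverse) (fun j => Function.update r D j)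
    (fun j hj => by
      refine ⟨w[j], w.drop (j + 1), List.drop_eq_getElem_cons hj, ?_⟩
      show Runs _ _ (split w (j + 1) _) _
      rw [split_succ_eq_cons_right w hj]
      exact (runs_push_aux _ _ _ _).seq (runs_incr _ _ _ _ _ (by simp)))
    (List.drop_eq_nil_of_le le_rfl)
  have h2 := runs_while_aux (t := 1) (f := fun x => .push .inp x) w.length
    (fun j => w.drop (w.length - j)) (fun j => (w.take (w.length - j)).reverse)
    (fun _ => Function.update r D w.length)
    (fun j hj => by
      obtain ⟨i, hi⟩ : ∃ i, w.length - j = i + 1 := ⟨w.length - j - 1, by omega⟩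
      have hi' : w.length - (j + 1) = i := by omega
      have hil : i < w.length := by omega
      simp only [hi, hi']
      refine ⟨w[i], (w.take i).reverse, ?_, ?_⟩
      · rw [List.take_add_one, List.getElem?_eq_getElem hil, List.reverse_append]
        rfl
      · rw [List.drop_eq_getElem_cons hil]
        exact runs_push_inp _ _ _ _)
    (by simp)
  simp only [Nat.sub_zero, Nat.sub_self, List.drop_zero, List.take_zero, List.reverse_nil] at h1 h2
  rw [show Function.update r D 0 = r by rw [← hD, Function.update_eq_self]] at h1
  exact h1.seq h2

open Classical in
/-- Replace the number in the register `D` by the truth value of the statement that the symbol `a`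
stands at this position of the word. -/
noncomputable def symProg (a : A) (D D' : Fin m) : MProg A m :=
  .seq (loop D (.seq (incr D') stepRight)) (.seq
    (.casePop .inp .skip fun x => .seq (.push .inp x) (if x = a then incr D else .skip))
    (loop D' stepLeft))

open Classical in
-- Walk right as far as `D` says while counting in `D'`, inspect the next symbol and put it back,
-- then walk left as far as `D'` says.
theorem runs_symProg (a : A) {D D' : Fin m} (hD : D ≠ D') (w : List A) (r r' : Fin m → ℕ)
    (hD' : r D' = 0) (h : r' = Function.update r D (if w[r D]? = some a then 1 else 0)) :
    Runs (symProg a D D') (stks w [] r) (stks w [] r')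
      ((r D * 4 + 1) + (3 + (r D * 3 + 1))) := by
  have h1 := runs_loop (p := .seq (incr D') stepRight) (t := 1 + 2) D (r D) (fun j => w.drop j)
    (fun j => (w.take j).reverse)
    (fun j => Function.update (Function.update r D' j) D (r D - j))
    (fun j _ => by simp) (fun j _ => (runs_incr _ _ _ _ _ (by
      funext l; simp only [Function.update_apply]; split_ifs <;> simp_all)).seq
        (runs_stepRight w j _))
  set n := r D with hn
  set c := if w[n]? = some a then 1 else 0 with hc
  have h2 : Runs (.casePop .inp .skip fun x => .seq (.push .inp x) (if x = a then incr D else .skip))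
      (split w n (Function.update (Function.update r D' n) D 0))
      (split w n (Function.update (Function.update r D' n) D c)) 3 := by
    by_cases h : n < w.length
    · rw [split_eq_cons_left w h, split_eq_cons_left w h]
      refine runs_case_inp (t := 2) ((runs_push_inp _ _ _ _).seq (t' := 1) ?_)
      rw [List.getElem?_eq_getElem h] at hc
      split_ifs with ha
      · exact runs_incr _ _ _ _ _ (by simp [hc, ha])
      · have : c = 0 := by simp [hc, ha]
        rw [this]
        exact (Runs.skip _).mono (by omega)
    · have : c = 0 := by simp [hc, List.getElem?_eq_none (show w.length ≤ n by omega)]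
      rw [this]
      unfold split
      rw [List.drop_eq_nil_of_le (Nat.le_of_not_lt h)]
      exact (runs_case_inp_nil (Runs.skip _)).mono (by omega)
  -- If `n` exceeds the length, the walk to the right stopped at the end of the word. The walk back
  -- then starts at `min n w.length`, and its surplus steps do nothing at the left end.
  have h3 := runs_loop (p := stepLeft) (t := 2) D' n (fun j => w.drop (min n w.length - j))
    (fun j => (w.take (min n w.length - j)).reverse)
    (fun j => Function.update (Function.update r D' (n - j)) D c)
    (fun j _ => by simp [hD.symm]) (fun j _ => by
      have := runs_stepLeft w (min n w.length - j) (by omega)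
        (Function.update (Function.update r D' (n - (j + 1))) D c)
      rw [Nat.sub_sub] at this
      rw [Function.update_comm hD, Function.update_idem]
      exact this)
  have e1 : Function.update (Function.update r D' 0) D (n - 0) = r := by
    funext l; simp only [Function.update_apply]; split_ifs <;> simp_all
  have e3 : Function.update (Function.update r D' (n - n)) D c = r' := by
    rw [h]; funext l; simp only [Function.update_apply]; split_ifs <;> simp_all
  have e4 : min n w.length - n = 0 := by omega
  simp only [e1, e3, e4] at h1 h3
  simp only [Nat.sub_self, List.drop_zero, List.take_zero, List.reverse_nil, Nat.sub_zero] at h1 h3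
  refine h1.seq (h2.seq ?_)
  have e5 : split w n (Function.update (Function.update r D' n) D c) =
      split w (min n w.length) (Function.update (Function.update r D' n) D c) := by
    rcases le_total n w.length with h | h
    · rw [min_eq_left h]
    · rw [min_eq_right h]; exact split_of_le w _ h le_rfl
  rw [e5]
  exact h3

end Walk

end EqQCSP

/-! ### Evaluation of bounded sums by register programs -/

namespace EqQCSP

open Turing

variable {A : Type}

/-- `f` is computed by programs in polynomial time: the variables are read from the registers
`env i`, which lie below `d`, the value is written into the register `d`, and only finitely many
further registers, which are empty before and after the computation, are used. -/
def Computes (f : List A → (ℕ → ℕ) → ℕ) : Prop :=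
  ∃ (c : ℕ) (T : Polynomial ℕ), ∀ (m d : ℕ) (hd : d + c < m) (env : ℕ → Fin m),
    (∀ i, (env i).val < d) → ∃ p : MProg A m, ∀ (w : List A) (r : Fin m → ℕ) (N : ℕ),
      w.length ≤ N → (∀ i, r i ≤ N) → (∀ i : Fin m, d ≤ i.val → r i = 0) →
      Runs p (stks w [] r)
        (stks w [] (Function.update r ⟨d, by omega⟩ (f w fun i => r (env i)))) (T.eval N)

theorem computes_var (i : ℕ) : Computes (A := A) fun _ v => v i := by
  refine ⟨1, .C 5 * .X + 2, fun m d hd env henv =>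
    ⟨.seq (loop (env i) (.seq (incr ⟨d, by omega⟩) (incr ⟨d + 1, by omega⟩)))
      (loop ⟨d + 1, by omega⟩ (incr (env i))), fun w r N hw hN hz => ?_⟩⟩
  · have h1 : env i ≠ ⟨d, by omega⟩ := fun h => by have := henv i; rw [h] at this; simp at this
    have h2 : env i ≠ ⟨d + 1, by omega⟩ := fun h => by
      have := henv i; rw [h] at this; simp at this
    refine (runs_copy h1 h2 (by simp) w [] r _ (hz _ le_rfl) (hz _ (by simp)) rfl).mono ?_
    have := hN (env i)
    simp only [Polynomial.eval_add, Polynomial.eval_mul, Polynomial.eval_C, Polynomial.eval_X,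
      Polynomial.eval_ofNat]
    omega

theorem computes_one : Computes (A := A) fun _ _ => 1 := by
  refine ⟨0, 1, fun m d hd env henv => ⟨incr ⟨d, by omega⟩, fun w r N hw hN hz => ?_⟩⟩
  rw [Polynomial.eval_one]
  exact runs_incr _ _ _ _ _ (by rw [hz _ le_rfl])

theorem computes_len : Computes (A := A) fun w _ => w.length := by
  refine ⟨0, .C 5 * .X + 2, fun m d hd env henv => ⟨lenProg ⟨d, by omega⟩,
    fun w r N hw hN hz => ?_⟩⟩
  refine (runs_lenProg _ w r (hz _ le_rfl)).mono ?_
  simp only [Polynomial.eval_add, Polynomial.eval_mul, Polynomial.eval_C, Polynomial.eval_X,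
    Polynomial.eval_ofNat]
  omega

open Classical in
theorem computes_sym (a : A) {f : List A → (ℕ → ℕ) → ℕ} (hf : BSum f) (h : Computes f) :
    Computes fun w v => if w[f w v]? = some a then 1 else 0 := by
  obtain ⟨q, hq⟩ := hf.bounded
  obtain ⟨c, T, h⟩ := h
  refine ⟨c + 1, T + .C 7 * q + 5, fun m d hd env henv => ?_⟩
  obtain ⟨p, hp⟩ := h m d (by omega) env henv
  refine ⟨.seq p (symProg a ⟨d, by omega⟩ ⟨d + 1, by omega⟩), fun w r N hw hN hz => ?_⟩
  have hv := hq w (fun i => r (env i)) N hw fun k => hN _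
  refine ((hp w r N hw hN hz).seq (runs_symProg a (by simp) w _ _ ?_ ?_)).mono ?_
  · rw [Function.update_of_ne (by simp)]
    exact hz _ (by simp)
  · simp
  · simp only [Polynomial.eval_add, Polynomial.eval_mul, Polynomial.eval_C,
      Polynomial.eval_ofNat, Function.update_self]
    omega

theorem update_le {m N M a : ℕ} {r : Fin m → ℕ} (hN : ∀ i, r i ≤ N) (h : N ≤ M) (ha : a ≤ M)
    (k i : Fin m) : Function.update r k a i ≤ M := by
  rw [Function.update_apply]
  split_ifs
  exacts [ha, (hN i).trans h]

/-- Two values in consecutive registers. -/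
theorem runs_pair {f g : List A → (ℕ → ℕ) → ℕ} (hf : BSum f) (ihf : Computes f) (ihg : Computes g) :
    ∃ (c : ℕ) (T : Polynomial ℕ), ∀ (m d : ℕ) (hd : d + c + 1 < m) (env : ℕ → Fin m),
      (∀ i, (env i).val < d) → ∃ p : MProg A m, ∀ (w : List A) (r : Fin m → ℕ) (N : ℕ),
        w.length ≤ N → (∀ i, r i ≤ N) → (∀ i : Fin m, d ≤ i.val → r i = 0) →
        Runs p (stks w [] r) (stks w [] (Function.update (Function.update r ⟨d, by omega⟩
          (f w fun i => r (env i))) ⟨d + 1, by omega⟩ (g w fun i => r (env i)))) (T.eval N) := by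
  obtain ⟨q, hq⟩ := hf.bounded
  obtain ⟨c, T, h⟩ := ihf
  obtain ⟨c', T', h'⟩ := ihg
  -- The second program runs while the first value is stored, so the bound on its registers is `N +
  -- q(N)`.
  refine ⟨c + c', T + T'.comp (.X + q), fun m d hd env henv => ?_⟩
  obtain ⟨p, hp⟩ := h m d (by omega) env henv
  obtain ⟨p', hp'⟩ := h' m (d + 1) (by omega) env fun i => (henv i).trans (by omega)
  refine ⟨.seq p p', fun w r N hw hN hz => ?_⟩
  have hv := hq w (fun i => r (env i)) N hw fun k => hN _
  have e : (fun i => Function.update r ⟨d, by omega⟩ (f w fun i => r (env i)) (env i)) =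
      fun i => r (env i) := by
    funext i
    exact Function.update_of_ne (fun h => by have := henv i; rw [h] at this; simp at this) _ _
  have h2 := hp' w (Function.update r ⟨d, by omega⟩ (f w fun i => r (env i))) (N + q.eval N)
    (by omega) (update_le hN (by omega) (by omega) _) (fun i hi => by
      rw [Function.update_of_ne (fun h => by rw [h] at hi; simp at hi)]
      exact hz i (by omega))
  rw [e] at h2
  refine ((hp w r N hw hN hz).seq h2).mono ?_
  simp

theorem computes_add {f g : List A → (ℕ → ℕ) → ℕ} (hf : BSum f) (hg : BSum g) (ihf : Computes f)
    (ihg : Computes g) : Computes fun w v => f w v + g w v := by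
  obtain ⟨q, hq⟩ := hg.bounded
  obtain ⟨c, T, h⟩ := runs_pair hf ihf ihg
  refine ⟨c + 1, T + .C 2 * q + 1, fun m d hd env henv => ?_⟩
  obtain ⟨p, hp⟩ := h m d (by omega) env henv
  refine ⟨.seq p (loop ⟨d + 1, by omega⟩ (incr ⟨d, by omega⟩)), fun w r N hw hN hz => ?_⟩
  have hv := hq w (fun i => r (env i)) N hw fun k => hN _
  refine ((hp w r N hw hN hz).seq (runs_move (by simp) w [] _ _ ?_)).mono ?_
  · have := hz ⟨d + 1, by omega⟩ (by simp)
    funext l; simp only [Function.update_apply]; split_ifs <;> simp_all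
  · simp only [Polynomial.eval_add, Polynomial.eval_mul, Polynomial.eval_C,
      Polynomial.eval_one, Function.update_self]
    omega

theorem runs_casePop_reg_skip {m : ℕ} (i : Fin m) (x y : List A) (r : Fin m → ℕ) :
    Runs (.casePop (.reg i) .skip fun _ => .skip) (stks x y r)
      (stks x y (Function.update r i (r i - 1))) 1 := by
  rcases Nat.eq_zero_or_pos (r i) with h | h
  · refine (Runs.case_nil ?_ ?_).mono (t := 1 + 0) le_rfl
    · show List.replicate (r i) () = []
      rw [h]; rfl
    · rw [show r i - 1 = r i by omega, Function.update_eq_self]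
      exact Runs.skip _
  · refine (Runs.case_cons (a := ()) (l := List.replicate (r i - 1) ()) ?_ ?_).mono
      (t := 1 + 0) le_rfl
    · show List.replicate (r i) () = _
      rw [show r i = r i - 1 + 1 by omega]; rfl
    · rw [update_reg]
      exact Runs.skip _

theorem computes_sub {f g : List A → (ℕ → ℕ) → ℕ} (hf : BSum f) (hg : BSum g) (ihf : Computes f)
    (ihg : Computes g) : Computes fun w v => f w v - g w v := by
  obtain ⟨q, hq⟩ := hg.bounded
  obtain ⟨c, T, h⟩ := runs_pair hf ihf ihg
  refine ⟨c + 1, T + .C 2 * q + 1, fun m d hd env henv => ?_⟩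
  obtain ⟨p, hp⟩ := h m d (by omega) env henv
  refine ⟨.seq p (loop ⟨d + 1, by omega⟩ (.casePop (.reg ⟨d, by omega⟩) .skip fun _ => .skip)),
    fun w r N hw hN hz => ?_⟩
  have hv := hq w (fun i => r (env i)) N hw fun k => hN _
  set D : Fin m := ⟨d, by omega⟩ with hD
  set D1 : Fin m := ⟨d + 1, by omega⟩ with hD1
  have hne : D ≠ D1 := by simp [hD, hD1]
  set a := f w fun i => r (env i)
  set b := g w fun i => r (env i)
  have h2 := runs_loop (p := .casePop (.reg D) .skip fun _ => .skip) (t := 1) D1 b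
    (fun _ => w) (fun _ => [])
    (fun j => Function.update (Function.update r D (a - j)) D1 (b - j))
    (fun j _ => by simp) (fun j _ => by
      have := runs_casePop_reg_skip D w []
        (Function.update (Function.update r D (a - j)) D1 (b - (j + 1)))
      rw [Function.update_idem]
      convert this using 2
      funext l; simp only [Function.update_apply]; split_ifs <;> (simp_all; try omega))
  have e : Function.update (Function.update r D (a - b)) D1 (b - b) =
      Function.update r D (a - b) := by
    have := hz D1 (by simp [hD1])
    funext l; simp only [Function.update_apply]; split_ifs <;> simp_all
  simp only [Nat.sub_zero, e] at h2
  refine ((hp w r N hw hN hz).seq h2).mono ?_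
  simp only [Polynomial.eval_add, Polynomial.eval_mul, Polynomial.eval_C,
    Polynomial.eval_one]
  omega

/-- The loop that sums up the values `G 0, …, G (B - 1)` computed by `p`. -/
theorem runs_sum_loop {m : ℕ} {D D1 D2 D3 : Fin m} (h01 : D ≠ D1) (h02 : D ≠ D2) (h03 : D ≠ D3)
    (h12 : D1 ≠ D2) (h13 : D1 ≠ D3) (h23 : D2 ≠ D3) (w : List A) (r : Fin m → ℕ) (hz0 : r D = 0)
    (hz1 : r D1 = 0) (hz2 : r D2 = 0) (hz3 : r D3 = 0) (G : ℕ → ℕ) (B t V : ℕ) (p : MProg A m)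
    (hV : ∀ j < B, G j ≤ V)
    (hp : ∀ j < B, ∀ s, s = Function.update (Function.update (Function.update r D
      (∑ i ∈ Finset.range j, G i)) D1 (B - (j + 1))) D2 j →
      Runs p (stks w [] s) (stks w [] (Function.update s D3 (G j))) t) :
    Runs (.seq (loop D1 (.seq (.seq p (loop D3 (incr D))) (incr D2))) (loop D2 .skip))
      (stks w [] (Function.update r D1 B))
      (stks w [] (Function.update r D (∑ i ∈ Finset.range B, G i)))
      ((B * (1 + (t + (V * 2 + 1) + 1)) + 1) + (B * 1 + 1)) := by
  -- The registers before pass `j`: partial sum in `D`, remaining passes in `D1`, summation index in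
  -- `D2`; `D3` receives each summand and is emptied into `D`.
  set s : ℕ → Fin m → ℕ := fun j => Function.update (Function.update (Function.update r D
    (∑ i ∈ Finset.range j, G i)) D1 (B - j)) D2 j with hs
  have h2 := runs_loop (p := .seq (.seq p (loop D3 (incr D))) (incr D2))
    (t := t + (V * 2 + 1) + 1) D1 B (fun _ => w) (fun _ => []) s
    (fun j _ => by simp [hs, h12]) (fun j hj => by
      set s' := Function.update (Function.update (Function.update r D
        (∑ i ∈ Finset.range j, G i)) D1 (B - (j + 1))) D2 j with hs'
      have e : Function.update (s j) D1 (B - (j + 1)) = s' := by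
        simp only [hs, hs']
        rw [Function.update_comm h12.symm, Function.update_idem]
      rw [e]
      have h4 := runs_move (i := D3) (k := D) h03.symm w [] (Function.update s' D3 (G j))
        (Function.update s' D (∑ i ∈ Finset.range (j + 1), G i)) (by
          rw [Finset.sum_range_succ]
          have e0 : s' D = ∑ i ∈ Finset.range j, G i := by simp [hs', h01, h02]
          have e3 : s' D3 = 0 := by simp [hs', h13.symm, h03.symm, h23.symm, hz3]
          funext l; simp only [Function.update_apply]; split_ifs <;> simp_all)
      have h5 := runs_incr D2 w [] (Function.update s' D (∑ i ∈ Finset.range (j + 1), G i))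
        (s (j + 1)) (by
          rw [Function.update_of_ne h02.symm]
          rw [hs', Function.update_self]
          simp only [hs]
          generalize ∑ i ∈ Finset.range (j + 1), G i = a
          generalize ∑ i ∈ Finset.range j, G i = b
          clear * - h01 h02 h12
          funext l; simp only [Function.update_apply]; split_ifs <;> simp_all)
      refine (((hp j hj s' rfl).seq h4).seq h5).mono ?_
      rw [Function.update_self]
      have := hV j hj
      omega)
  have e0 : s 0 = Function.update r D1 B := by
    funext l; simp only [hs, Function.update_apply]; split_ifs <;> simp_all
  rw [e0] at h2
  have h6 := runs_clear D2 w [] (s B) (Function.update r D (∑ i ∈ Finset.range B, G i)) (by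
    funext l; simp only [hs, Function.update_apply]; split_ifs <;> simp_all)
  have e2 : s B D2 = B := by simp [hs]
  rw [e2] at h6
  exact h2.seq h6

/-- The range is evaluated into `D1`, leaving the accumulator `D` empty. The summand is evaluated
from register `d + 3` on, in an environment where the bound variable is read from the index register
`D2`. -/
theorem computes_sum {f g : List A → (ℕ → ℕ) → ℕ} (hf : BSum f) (hg : BSum g) (ihf : Computes f)
    (ihg : Computes g) :
    Computes fun w v => ∑ i ∈ Finset.range (f w v), g w (consEnv i v) := by
  obtain ⟨qs, hqs⟩ := (BSum.sum hf hg).bounded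
  obtain ⟨q, hq⟩ := hf.bounded
  obtain ⟨c, T, h⟩ := ihf
  obtain ⟨c', T', h'⟩ := ihg
  -- During the loop the registers hold inputs (at most `N`), countdown and index (at most `q`) and
  -- partial sums (at most `qs`), so `T'` is evaluated at the sum of the three bounds.
  refine ⟨c + c' + 3, T + ((q * (1 + (T'.comp (.X + q + qs) + (qs * .C 2 + 1) + 1)) + 1) +
    (q * 1 + 1)), fun m d hd env henv => ?_⟩
  set D : Fin m := ⟨d, by omega⟩ with hD
  set D1 : Fin m := ⟨d + 1, by omega⟩ with hD1
  set D2 : Fin m := ⟨d + 2, by omega⟩ with hD2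
  set D3 : Fin m := ⟨d + 3, by omega⟩ with hD3
  have henv' : ∀ i, (consEnv D2 env i).val < d + 3 := by
    intro i
    cases i with
    | zero => simp [consEnv, hD2]
    | succ i => exact (henv i).trans (by omega)
  obtain ⟨p, hp⟩ := h m (d + 1) (by omega) env fun i => (henv i).trans (by omega)
  obtain ⟨p', hp'⟩ := h' m (d + 3) (by omega) (consEnv D2 env) henv'
  refine ⟨.seq p (.seq (loop D1 (.seq (.seq p' (loop D3 (incr D))) (incr D2))) (loop D2 .skip)),
    fun w r N hw hN hz => ?_⟩
  have hne : ∀ {i l : Fin m}, i.val ≠ l.val → i ≠ l := fun h h' => h (by rw [h'])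
  have he0 : ∀ i, env i ≠ D := fun i => hne (by have := henv i; simp only [hD]; omega)
  have he1 : ∀ i, env i ≠ D1 := fun i => hne (by have := henv i; simp only [hD1]; omega)
  have he2 : ∀ i, env i ≠ D2 := fun i => hne (by have := henv i; simp only [hD2]; omega)
  have hvs := hqs w (fun i => r (env i)) N hw fun k => hN _
  have hv := hq w (fun i => r (env i)) N hw fun k => hN _
  have h1 := hp w r N hw hN fun i hi => hz i (by omega)
  set v : ℕ → ℕ := fun i => r (env i) with hvdef
  have hle : ∀ j ≤ f w v, ∑ i ∈ Finset.range j, g w (consEnv i v) ≤ qs.eval N := fun j hj =>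
    (Finset.sum_le_sum_of_subset (Finset.range_mono hj)).trans hvs
  have hle' : ∀ j < f w v, g w (consEnv j v) ≤ qs.eval N := fun j hj => by
    have := hle (j + 1) hj
    rw [Finset.sum_range_succ] at this
    omega
  have h2 := runs_sum_loop (D := D) (D1 := D1) (D2 := D2) (D3 := D3) (hne (by simp [hD, hD1]))
    (hne (by simp [hD, hD2])) (hne (by simp [hD, hD3])) (hne (by simp [hD1, hD2]))
    (hne (by simp [hD1, hD3])) (hne (by simp [hD2, hD3])) w r (hz _ (by simp [hD]))
    (hz _ (by simp [hD1])) (hz _ (by simp [hD2])) (hz _ (by simp [hD3]))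
    (fun i => g w (consEnv i v)) (f w v) (T'.eval (N + q.eval N + qs.eval N)) (qs.eval N) p' hle'
    (fun j hj s hs => by
      have hsum := hle j hj.le
      have e1 : (fun i => s (consEnv D2 env i)) = consEnv j v := by
        funext i
        cases i with
        | zero => simp [consEnv, hs]
        | succ i => simp [consEnv, hs, he0, he1, he2, hvdef]
      have h3 := hp' w s (N + q.eval N + qs.eval N) (by omega) (fun i => by
          have := hN i
          rw [hs]; simp only [Function.update_apply]; split_ifs <;> omega)
        (fun i hi => by
          rw [hs, Function.update_of_ne (hne (by simp only [hD2]; omega)),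
            Function.update_of_ne (hne (by simp only [hD1]; omega)),
            Function.update_of_ne (hne (by simp only [hD]; omega))]
          exact hz i (by omega))
      rw [e1] at h3
      exact h3)
  refine (h1.seq h2).mono ?_
  simp only [Polynomial.eval_add, Polynomial.eval_mul, Polynomial.eval_C, Polynomial.eval_X,
    Polynomial.eval_one, Polynomial.eval_comp]
  gcongr

theorem BSum.computes {f : List A → (ℕ → ℕ) → ℕ} (h : BSum f) : Computes f := by
  induction h with
  | var i => exact computes_var i
  | one => exact computes_one
  | len => exact computes_len
  | sym a hf ih => exact computes_sym a hf ih
  | add hf hg ihf ihg => exact computes_add hf hg ihf ihg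
  | sub hf hg ihf ihg => exact computes_sub hf hg ihf ihg
  | sum hf hg ihf ihg => exact computes_sum hf hg ihf ihg

end EqQCSP

/-! ### From bounded sums to membership in NP -/

namespace EqQCSP

open Turing

/-- Leave nothing but the symbol `b` on the output stack. -/
def finish {A : Type} {m : ℕ} (D : Fin m) (b : Bool) : MProg A m :=
  .seq (.seq (loop D .skip) (.whilePop (Γ := StkAlpha A) .inp fun _ => .skip))
    (.push (Γ := StkAlpha A) .out b)

/-- The stacks with a single symbol on the output stack and nothing else. -/
def outStks {A : Type} {m : ℕ} (b : Bool) : ∀ k : Stk m, List (StkAlpha A k)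
  | .inp => []
  | .aux => []
  | .out => [b]
  | .reg _ => []

theorem runs_finish {A : Type} {m : ℕ} (D : Fin m) (b : Bool) (w : List A) (r : Fin m → ℕ)
    (hr : ∀ i, i ≠ D → r i = 0) :
    Runs (finish D b) (stks w [] r) (outStks b) ((r D * 1 + 1) + (w.length * 1 + 1) + 1) := by
  have h1 := runs_clear D w [] r (fun _ => 0) (by
    funext i
    rw [Function.update_apply]
    split_ifs with h
    exacts [rfl, (hr i h).symm])
  have h2 := runs_while_inp (t := 0) (f := fun _ : A => (.skip : MProg A m)) w.length
    (fun j => w.drop j) (fun _ => []) (fun _ _ => 0)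
    (fun j hj => ⟨w[j], w.drop (j + 1), List.drop_eq_getElem_cons hj, Runs.skip _⟩)
    (List.drop_eq_nil_of_le le_rfl)
  simp only [List.drop_zero, List.drop_length] at h2
  refine (h1.seq h2).seq (.push _ ?_)
  funext k; cases k <;> rfl

/-- The verifier computes `f` on the combined word and tests the result for zero. All other stacks
must be emptied, as the halting configuration contains the output only. -/
theorem inNP_of_bsum {G : Type} [Finite G] (L : Language G)
    {f : List (G ⊕ Bool) → (ℕ → ℕ) → ℕ} (hf : BSum f) (p : Polynomial ℕ)
    (h : ∀ x, x ∈ L ↔ ∃ c : List Bool, c.length ≤ p.eval x.length ∧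
      f (pairWord (x, c)) (fun _ => 0) ≠ 0) : InNP L := by
  classical
  have := Fintype.ofFinite G
  refine ⟨Bool, inferInstance, fun z => decide (f (pairWord z) (fun _ => 0) ≠ 0), p, ?_,
    fun x => by rw [h]; simp⟩
  obtain ⟨c, T, hT⟩ := hf.computes
  obtain ⟨q, hq⟩ := hf.bounded
  -- Register `0` stays zero and serves as every free variable; the value appears in register `1`.
  obtain ⟨P, hP⟩ := hT (c + 2) 1 (by omega) (fun _ => ⟨0, by omega⟩) (fun _ => by simp)
  set D : Fin (c + 2) := ⟨1, by omega⟩ with hD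
  set Q : MProg (G ⊕ Bool) (c + 2) := .seq P (.casePop (Γ := StkAlpha (G ⊕ Bool)) (.reg D)
    (finish D false) fun _ => finish D true) with hQ
  have key : ∀ z : List G × List Bool, Runs Q (stks (pairWord z) [] fun _ => 0)
      (outStks (decide (f (pairWord z) (fun _ => 0) ≠ 0)))
      (T.eval (pairWord z).length + (1 + (q.eval (pairWord z).length + (pairWord z).length + 3))) := by
    intro z
    set w := pairWord z
    set v := f w fun _ => 0 with hv
    have hvq : v ≤ q.eval w.length := hq w (fun _ => 0) w.length le_rfl (fun _ => Nat.zero_le _)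
    have h1 := hP w (fun _ => 0) w.length le_rfl (fun _ => Nat.zero_le _) (fun _ _ => rfl)
    refine h1.seq ?_
    rcases Nat.eq_zero_or_pos v with h0 | h0
    · have e : Function.update (fun _ : Fin (c + 2) => 0) D v = fun _ => 0 := by
        rw [h0]; exact Function.update_eq_self _ _
      rw [e, h0]
      exact Runs.case_nil (by rfl) ((runs_finish D false w _ fun _ _ => rfl).mono (by omega))
    · have e : decide (v ≠ 0) = true := by simpa using h0.ne'
      rw [e]
      refine Runs.case_cons (a := ()) (l := List.replicate (v - 1) ()) ?_ ?_
      · show List.replicate (Function.update (fun _ : Fin (c + 2) => 0) D v D) () = _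
        rw [Function.update_self, show v = v - 1 + 1 by omega]; rfl
      · rw [update_reg, Function.update_idem]
        refine (runs_finish D true w _ fun i hi => Function.update_of_ne hi _ _).mono ?_
        rw [Function.update_self]
        omega
  refine ⟨{ tm := Q.machine .inp .out, inputAlphabet := Equiv.refl _, outputAlphabet := Equiv.refl _,
            time := T + (1 + (q + .X + 3)) + 1, outputsFun := fun z => Classical.choice ?_ }⟩
  obtain ⟨t, ht, hex⟩ := key z
  obtain ⟨v', hs⟩ := hex.stepsTo (Q.machine .inp .out).m none some (fun l => rfl) none
  have hs' := hs.trans (.one (c' := ⟨none, none, outStks (decide (f (pairWord z) (fun _ => 0) ≠ 0))⟩)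
    rfl)
  have e1 : initList (Q.machine .inp .out) ((pairWord z).map (Equiv.refl _).invFun) =
      ⟨some (Q.entry none some), none, stks (pairWord z) [] fun _ => 0⟩ := by
    unfold initList
    congr 1
    funext k
    cases k with
    | inp => exact List.map_id _
    | _ => rfl
  have e2 : ∀ b : Bool, haltList (Q.machine .inp .out)
      ((Computability.encodeBool b).map (Equiv.refl _).invFun) = ⟨none, none, outStks b⟩ := by
    intro b
    unfold haltList
    congr 1
    funext k
    cases k <;> rfl
  refine ⟨⟨⟨t + 1, ?_⟩, ?_⟩⟩
  · refine Eq.trans ?_ (Eq.trans hs' ?_)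
    · exact congrArg (fun c => (flip bind (TM2.step (Q.machine .inp .out).m))^[t + 1] (some c)) e1
    · exact congrArg some (e2 _).symm
  · simp only [Polynomial.eval_add, Polynomial.eval_X, Polynomial.eval_one, Polynomial.eval_ofNat]
    omega

end EqQCSP

namespace EqQCSP

/-! ### Closure properties of the functions and predicates built from bounded sums -/

variable {A : Type}

theorem BSum.rename {f : List A → (ℕ → ℕ) → ℕ} (hf : BSum f) (ρ : ℕ → ℕ) :
    BSum fun w v => f w fun k => v (ρ k) := by
  induction hf generalizing ρ with
  | var i => exact .var _
  | one => exact .one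
  | len => exact .len
  | sym a _ ih => exact .sym a (ih ρ)
  | add _ _ ihf ihg => exact .add (ihf ρ) (ihg ρ)
  | sub _ _ ihf ihg => exact .sub (ihf ρ) (ihg ρ)
  | sum _ _ ihf ihg =>
    rename_i f g _ _
    have h := BSum.sum (ihf ρ) (ihg (consEnv 0 fun k => ρ k + 1))
    have e : ∀ (i : ℕ) (v : ℕ → ℕ), (fun k => consEnv i v (consEnv 0 (fun k => ρ k + 1) k)) =
        consEnv i fun k => v (ρ k) := by
      intro i v; funext k; cases k <;> rfl
    simpa only [e] using h

/-- Variables are de Bruijn indices: below a sum, index `0` is kept and the substituted functions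
are shifted by one. -/
theorem BSum.subst {f : List A → (ℕ → ℕ) → ℕ} (hf : BSum f)
    (s : ℕ → List A → (ℕ → ℕ) → ℕ) (hs : ∀ k, BSum (s k)) :
    BSum fun w v => f w fun k => s k w v := by
  induction hf generalizing s with
  | var i => exact hs i
  | one => exact .one
  | len => exact .len
  | sym a _ ih => exact .sym a (ih s hs)
  | add _ _ ihf ihg => exact .add (ihf s hs) (ihg s hs)
  | sub _ _ ihf ihg => exact .sub (ihf s hs) (ihg s hs)
  | sum _ _ ihf ihg =>
    rename_i f g _ _
    have h := BSum.sum (ihf s hs) (ihg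
      (consEnv (fun _ v => v 0) fun k w v => s k w fun j => v (j + 1)) fun k => by
        cases k with
        | zero => exact .var 0
        | succ k => exact (hs k).rename _)
    have e : ∀ (i : ℕ) (w : List A) (v : ℕ → ℕ), (fun k => (consEnv (fun _ v => v 0)
        (fun k w v => s k w fun j => v (j + 1)) : ℕ → List A → (ℕ → ℕ) → ℕ) k w (consEnv i v)) =
        consEnv i fun k => s k w v := by
      intro i w v; funext k; cases k <;> rfl
    simpa only [e] using h

/-- `BSum` as a type class, so that closure properties are found by instance search. -/
class BS (f : List A → (ℕ → ℕ) → ℕ) : Prop where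
  bsum : BSum f

open Classical in
/-- The predicates whose characteristic functions are built from bounded sums. -/
class BP (P : List A → (ℕ → ℕ) → Prop) : Prop where
  bsum : BSum fun w v => if P w v then 1 else 0

section Instances

variable {f g : List A → (ℕ → ℕ) → ℕ} {P Q : List A → (ℕ → ℕ) → Prop}

instance BS.var (i : ℕ) : BS (A := A) fun _ v => v i := ⟨.var i⟩

instance BS.const (c : ℕ) : BS (A := A) fun _ _ => c := by
  constructor
  induction c with
  | zero => simpa using BSum.sub (A := A) .one .one
  | succ c ih => exact .add ih .one

instance BS.length : BS (A := A) fun w _ => w.length := ⟨.len⟩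

instance BS.add [hf : BS f] [hg : BS g] : BS fun w v => f w v + g w v := ⟨.add hf.1 hg.1⟩

instance BS.sub [hf : BS f] [hg : BS g] : BS fun w v => f w v - g w v := ⟨.sub hf.1 hg.1⟩

/-- The premise has the bound variable as index `0` and the outer variables shifted, so that
instance search can continue below the binder. -/
instance BS.sum {g : List A → (ℕ → ℕ) → ℕ → ℕ} [hf : BS f]
    [hg : BS fun w v => g w (fun k => v (k + 1)) (v 0)] :
    BS fun w v => ∑ i ∈ Finset.range (f w v), g w v i := ⟨.sum hf.1 hg.1⟩

/-- A product is a bounded sum with constant summand. -/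
instance BS.mul [hf : BS f] [hg : BS g] : BS fun w v => f w v * g w v := by
  constructor
  have := BSum.sum hf.1 (hg.1.rename fun k => k + 1)
  simpa [consEnv] using this

instance BS.pow [hf : BS f] (k : ℕ) : BS fun w v => f w v ^ k := by
  induction k with
  | zero => simpa using BS.const (A := A) 1
  | succ k ih => simpa only [pow_succ] using BS.mul (f := fun w v => f w v ^ k) (g := f)

instance BS.char [hP : BP P] [∀ w v, Decidable (P w v)] :
    BS fun w v => if P w v then 1 else 0 := by
  constructor
  convert hP.1

instance BP.symbol (a : A) [hf : BS f] : BP fun w v => w[f w v]? = some a := by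
  constructor
  convert BSum.sym a hf.1

instance BP.not [hP : BP P] : BP fun w v => ¬ P w v := by
  constructor
  have := BSum.sub .one hP.1
  convert this using 3
  split_ifs <;> simp

instance BP.and [hP : BP P] [hQ : BP Q] : BP fun w v => P w v ∧ Q w v := by
  constructor
  have := (BS.mul (hf := ⟨hP.1⟩) (hg := ⟨hQ.1⟩)).1
  convert this using 3
  split_ifs <;> simp_all

instance BP.or [hP : BP P] [hQ : BP Q] : BP fun w v => P w v ∨ Q w v := by
  have : BP fun w v => ¬ (¬ P w v ∧ ¬ Q w v) := inferInstance
  simpa only [not_and_or, not_not] using this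

instance BP.imp [hP : BP P] [hQ : BP Q] : BP fun w v => P w v → Q w v := by
  have : BP fun w v => ¬ P w v ∨ Q w v := inferInstance
  simpa only [imp_iff_not_or] using this

instance BP.iff [hP : BP P] [hQ : BP Q] : BP fun w v => P w v ↔ Q w v := by
  have : BP fun w v => (P w v → Q w v) ∧ (Q w v → P w v) := inferInstance
  simpa only [iff_iff_implies_and_implies] using this

/-- With truncated subtraction, `1 - (f - g)` is the characteristic function. -/
instance BP.le [hf : BS f] [hg : BS g] : BP fun w v => f w v ≤ g w v := by
  constructor
  have := BSum.sub .one (.sub hf.1 hg.1)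
  convert this using 3
  split_ifs <;> omega

instance BP.lt [hf : BS f] [hg : BS g] : BP fun w v => f w v < g w v :=
  inferInstanceAs (BP fun w v => f w v + 1 ≤ g w v)

instance BP.eq [hf : BS f] [hg : BS g] : BP fun w v => f w v = g w v := by
  have : BP fun w v => f w v ≤ g w v ∧ g w v ≤ f w v := inferInstance
  simpa only [le_antisymm_iff] using this

/-- The number of counterexamples below the bound is a bounded sum, and it has to vanish. -/
instance BP.ball {P : List A → (ℕ → ℕ) → ℕ → Prop} [hf : BS f]
    [hP : BP fun w v => P w (fun k => v (k + 1)) (v 0)] :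
    BP fun w v => ∀ i < f w v, P w v i := by
  classical
  have h1 : BP fun w v => ¬ P w (fun k => v (k + 1)) (v 0) := inferInstance
  have h2 : BS fun w v => ∑ i ∈ Finset.range (f w v), if ¬ P w v i then 1 else 0 := by
    constructor
    convert BSum.sum hf.1 h1.1 <;> rfl
  have h3 : BP fun w v => (∑ i ∈ Finset.range (f w v), if ¬ P w v i then 1 else 0) = 0 :=
    inferInstance
  convert h3 using 4
  simp

instance BP.bex {P : List A → (ℕ → ℕ) → ℕ → Prop} [hf : BS f]
    [hP : BP fun w v => P w (fun k => v (k + 1)) (v 0)] :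
    BP fun w v => ∃ i < f w v, P w v i := by
  have h1 : BP fun w v => ¬ P w (fun k => v (k + 1)) (v 0) := inferInstance
  have h2 : BP fun w v => ¬ ∀ i < f w v, ¬ P w v i :=
    @BP.not _ _ (@BP.ball A f (fun w v i => ¬ P w v i) hf h1)
  simpa only [not_forall, not_not, exists_prop] using h2

end Instances

/-- Reduces definability at arbitrary arguments to definability at the variables `0` and `1`, so a
definition has to be unfolded only at variables. -/
theorem BS.subst₂ {F : List A → ℕ → ℕ → ℕ} (h : BS fun w v => F w (v 0) (v 1))
    (f g : List A → (ℕ → ℕ) → ℕ) [hf : BS f] [hg : BS g] : BS fun w v => F w (f w v) (g w v) :=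
  ⟨h.1.subst (fun k => match k with | 0 => f | _ => g) fun k => by
    rcases k with _ | k
    exacts [hf.1, hg.1]⟩

theorem BP.subst₂ {P : List A → ℕ → ℕ → Prop} (h : BP fun w v => P w (v 0) (v 1))
    (f g : List A → (ℕ → ℕ) → ℕ) [hf : BS f] [hg : BS g] : BP fun w v => P w (f w v) (g w v) :=
  ⟨h.1.subst (fun k => match k with | 0 => f | _ => g) fun k => by
    rcases k with _ | k
    exacts [hf.1, hg.1]⟩

end EqQCSP

namespace EqQCSP

/-! ### A calculus for the equalities forced in the game -/

/-- A sentence seen as a sequence of `m` tokens, each consisting of a symbol and a variable: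
`S i s` says that the `i`-th symbol is `s`, and `same i j` that the variables are the same. -/
structure Tokens where
  m : ℕ
  S : ℕ → Sym → Prop
  same : ℕ → ℕ → Prop

namespace Tokens

variable (t : Tokens)

/-- The token belongs to the prefix. -/
def IsQuant (i : ℕ) : Prop := t.S i .ex ∨ t.S i .all

open Classical in
/-- The number of maximal blocks of universal quantifiers that start at `j` or before. -/
noncomputable def lev (j : ℕ) : ℕ :=
  ∑ i ∈ Finset.range (j + 1), if t.S i .all ∧ ¬ (1 ≤ i ∧ t.S (i - 1) .all) then 1 else 0

/-- The patterns `σ` and `σ'` prescribe the same for all universal variables that are relevant for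
the tokens `a` and `b`. -/
def Agree (σ σ' : ℕ → ℕ) (a b : ℕ) : Prop :=
  ∀ i < t.m, t.S i .all → t.lev i ≤ t.lev a ∨ t.lev i ≤ t.lev b → σ i = σ' i

/-- One step of a derivation of equalities from given ones. A context `s` comes with a pattern
`sig s` for the universal player: the universal variable `i` gets the value of the variable
`sig s i` if this is an earlier one, and a fresh value if `sig s i = i`. -/
def Just {C : Type} (ctx : C → Prop) (sig : C → ℕ → ℕ) (R : C → ℕ → ℕ → Prop) (s : C) (a b : ℕ) :
    Prop :=
  t.same a b ∨ R s b a ∨ (∃ c < t.m, R s a c ∧ R s c b) ∨ (t.S a .all ∧ b = sig s a) ∨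
    (t.S a .and ∧ ¬ t.S (a + 2) .imp ∧ b = a + 1) ∨
    (∃ c < t.m, t.S c .and ∧ t.S (c + 2) .imp ∧ a = c + 2 ∧ b = c + 3 ∧ R s c (c + 1)) ∨
    -- The transfer rule, the only one that leaves the context. Since `Agree` compares whole
    -- universal blocks rather than prefixes, only the level of `a` and `b` matters.
    (t.IsQuant a ∧ t.IsQuant b ∧ ∃ s', ctx s' ∧ R s' a b ∧ t.Agree (sig s) (sig s') a b)

/-- A refutation with `M` contexts: `rk s a b` is positive if the equality of the tokens `a` and `b`
is derived in the context `s`, and derivations use equalities of smaller rank only. -/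
def Refut (M : ℕ) (sig : ℕ → ℕ → ℕ) (rk : ℕ → ℕ → ℕ → ℕ) : Prop :=
  (∀ s < M, ∀ i < t.m, sig s i ≤ i) ∧
  (∀ s < M, ∀ a < t.m, ∀ b < t.m, 0 < rk s a b →
    t.Just (fun s' => s' < M) sig (fun s' a' b' => 0 < rk s' a' b' ∧ rk s' a' b' < rk s a b) s a b) ∧
  ∃ s < M, ∃ x < t.m, ∃ b < x, t.S x .all ∧ sig s x = x ∧ 0 < rk s x b

variable {t}

theorem Just.mono {C : Type} {ctx : C → Prop} {sig : C → ℕ → ℕ} {R R' : C → ℕ → ℕ → Prop} {s : C}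
    {a b : ℕ} (h : t.Just ctx sig R s a b) (hR : ∀ s a b, R s a b → R' s a b) :
    t.Just ctx sig R' s a b := by
  rcases h with h | h | ⟨c, hc, h, h'⟩ | h | h | ⟨c, hc, h1, h2, h3, h4, h5⟩ |
    ⟨h1, h2, s', h3, h4, h5⟩
  · exact .inl h
  · exact .inr (.inl (hR _ _ _ h))
  · exact .inr (.inr (.inl ⟨c, hc, hR _ _ _ h, hR _ _ _ h'⟩))
  · exact .inr (.inr (.inr (.inl h)))
  · exact .inr (.inr (.inr (.inr (.inl h))))
  · exact .inr (.inr (.inr (.inr (.inr (.inl ⟨c, hc, h1, h2, h3, h4, hR _ _ _ h5⟩)))))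
  · exact .inr (.inr (.inr (.inr (.inr (.inr ⟨h1, h2, s', h3, hR _ _ _ h4, h5⟩)))))

variable (t) in
/-- A universal variable gets the value of an earlier one or a fresh value. -/
def Valid (σ : ℕ → ℕ) : Prop := ∀ i < t.m, σ i ≤ i

variable (t) in
/-- The equalities with a derivation of height less than `h`. -/
def DerH : ℕ → (ℕ → ℕ) → ℕ → ℕ → Prop
  | 0, _, _, _ => False
  | h + 1, σ, a, b => a < t.m ∧ b < t.m ∧ t.Just t.Valid id (DerH h) σ a b

variable (t) in
/-- The derivable equalities. -/
def Der (σ : ℕ → ℕ) (a b : ℕ) : Prop := ∃ h, t.DerH h σ a b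

theorem DerH.succ {h : ℕ} : ∀ {σ : ℕ → ℕ} {a b : ℕ}, t.DerH h σ a b → t.DerH (h + 1) σ a b := by
  induction h with
  | zero => exact fun h => h.elim
  | succ h ih => exact fun ⟨ha, hb, hj⟩ => ⟨ha, hb, hj.mono fun _ _ _ => ih⟩

theorem DerH.mono {h h' : ℕ} (hh : h ≤ h') {σ : ℕ → ℕ} {a b : ℕ} (hd : t.DerH h σ a b) :
    t.DerH h' σ a b := by
  induction hh with
  | refl => exact hd
  | step _ ih => exact ih.succ

namespace Der

variable {σ σ' : ℕ → ℕ} {a b c : ℕ}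

theorem lt_left (h : t.Der σ a b) : a < t.m := by
  obtain ⟨_ | h, hd⟩ := h
  exacts [hd.elim, hd.1]

theorem lt_right (h : t.Der σ a b) : b < t.m := by
  obtain ⟨_ | h, hd⟩ := h
  exacts [hd.elim, hd.2.1]

theorem of_same (ha : a < t.m) (hb : b < t.m) (h : t.same a b) : t.Der σ a b :=
  ⟨1, ha, hb, .inl h⟩

theorem symm (h : t.Der σ a b) : t.Der σ b a :=
  let ⟨n, hd⟩ := h
  ⟨n + 1, h.lt_right, h.lt_left, .inr (.inl hd)⟩

theorem trans (h : t.Der σ a b) (h' : t.Der σ b c) : t.Der σ a c :=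
  let ⟨n, hd⟩ := h
  let ⟨n', hd'⟩ := h'
  ⟨max n n' + 1, h.lt_left, h'.lt_right, .inr (.inr (.inl ⟨b, h.lt_right,
    hd.mono (le_max_left _ _), hd'.mono (le_max_right _ _)⟩))⟩

theorem of_all (ha : a < t.m) (h : t.S a .all) (hσ : t.Valid σ) : t.Der σ a (σ a) :=
  ⟨1, ha, (hσ a ha).trans_lt ha, .inr (.inr (.inr (.inl ⟨h, rfl⟩)))⟩

theorem of_eq (ha : a + 1 < t.m) (h : t.S a .and) (h' : ¬ t.S (a + 2) .imp) : t.Der σ a (a + 1) :=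
  ⟨1, by omega, ha, .inr (.inr (.inr (.inr (.inl ⟨h, h', rfl⟩))))⟩

theorem of_imp (ha : a + 3 < t.m) (h : t.S a .and) (h' : t.S (a + 2) .imp)
    (hd : t.Der σ a (a + 1)) : t.Der σ (a + 2) (a + 3) :=
  let ⟨n, hd⟩ := hd
  ⟨n + 1, by omega, ha, .inr (.inr (.inr (.inr (.inr (.inl
    ⟨a, by omega, h, h', rfl, rfl, hd⟩)))))⟩

theorem transfer (ha : t.IsQuant a) (hb : t.IsQuant b) (hσ : t.Valid σ')
    (h : t.Agree σ σ' a b) (hd : t.Der σ' a b) : t.Der σ a b :=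
  let ⟨n, hd'⟩ := hd
  ⟨n + 1, hd.lt_left, hd.lt_right, .inr (.inr (.inr (.inr (.inr (.inr
    ⟨ha, hb, σ', hσ, hd', h⟩)))))⟩

end Der

theorem lev_mono {i j : ℕ} (h : i ≤ j) : t.lev i ≤ t.lev j :=
  Finset.sum_le_sum_of_subset (Finset.range_mono (by omega))

/-- The first universal variable after the non-universal token `y` opens a new block. Hence
universal variables of level at most that of an existential one precede it. -/
theorem lev_lt {x y : ℕ} (hy : ¬ t.S y .all) (hx : t.S x .all) (h : y < x) :
    t.lev y < t.lev x := by
  classical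
  have hex : ∃ z, y < z ∧ t.S z .all := ⟨x, h, hx⟩
  obtain ⟨hz, hz'⟩ := Nat.find_spec hex
  have hmin : ∀ z' < Nat.find hex, ¬ (y < z' ∧ t.S z' .all) := fun z' => Nat.find_min hex
  have hzx : Nat.find hex ≤ x := Nat.find_min' hex ⟨h, hx⟩
  set z := Nat.find hex
  have h1 : t.lev y ≤ t.lev (z - 1) := lev_mono (by omega)
  have h2 : t.lev (z - 1) < t.lev z := by
    obtain ⟨u, hu⟩ : ∃ u, z = u + 1 := ⟨z - 1, by omega⟩
    rw [hu, Nat.add_sub_cancel]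
    unfold lev
    rw [Finset.sum_range_succ _ (u + 1), if_pos]
    · omega
    · refine ⟨hu ▸ hz', fun ⟨_, h'⟩ => ?_⟩
      rw [Nat.add_sub_cancel] at h'
      rcases eq_or_ne u y with rfl | hne
      · exact hy h'
      · exact hmin u (by omega) ⟨by omega, h'⟩
  exact h1.trans_lt (h2.trans_le (lev_mono hzx))

/-- The tokens `t`, with variables `nm`, represent the sentence with prefix `Q` and matrix `M`. -/
structure Represents (t : Tokens) (nm : ℕ → Var) (Q : List (Quant × Var)) (M : List Constraint) :
    Prop where
  le : Q.length ≤ t.m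
  nm_eq : ∀ i (h : i < Q.length), nm i = Q[i].2
  inj : ∀ i < Q.length, ∀ j < Q.length, nm i = nm j → i = j
  all_iff : ∀ i, t.S i .all ↔ ∃ h : i < Q.length, Q[i].1 = .all
  ex_iff : ∀ i, t.S i .ex ↔ ∃ h : i < Q.length, Q[i].1 = .ex
  same_iff : ∀ i < t.m, ∀ j < t.m, t.same i j ↔ nm i = nm j
  closed : ∀ i < t.m, ∃ j < Q.length, nm j = nm i
  and_lt : ∀ a, t.S a .and → a + 1 < t.m
  imp_lt : ∀ a, t.S a .and → t.S (a + 2) .imp → a + 3 < t.m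
  sat_iff : ∀ ρ : Var → ℕ, (∀ C ∈ M, C.Sat ρ) ↔
    (∀ a, t.S a .and → ¬ t.S (a + 2) .imp → ρ (nm a) = ρ (nm (a + 1))) ∧
    (∀ a, t.S a .and → t.S (a + 2) .imp → ρ (nm a) = ρ (nm (a + 1)) →
      ρ (nm (a + 2)) = ρ (nm (a + 3)))

theorem exists_fresh (f : ℕ → ℕ) (p : ℕ) : ∃ n, ∀ j < p, n ≠ f j := by
  refine ⟨∑ j ∈ Finset.range p, f j + 1, fun j hj h => ?_⟩
  have := Finset.single_le_sum (f := f) (fun _ _ => Nat.zero_le _) (Finset.mem_range.2 hj)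
  omega

/-! ### Soundness and completeness of the calculus -/

namespace Represents

variable {nm : ℕ → Var} {Q : List (Quant × Var)} {M : List Constraint}

/-- If the sentence is true, then a winning strategy of the existential player answers all patterns
of the universal player. -/
theorem exists_plays (hr : t.Represents nm Q M) (Q₂ : List (Quant × Var)) :
    ∀ (p : ℕ) (ρ : Var → ℕ), Q.drop p = Q₂ → p ≤ Q.length → Holds M Q₂ ρ →
    ∃ R : (ℕ → ℕ) → Var → ℕ, ∀ σ, t.Valid σ →
      (∀ j < p, R σ (nm j) = ρ (nm j)) ∧ (∀ C ∈ M, C.Sat (R σ)) ∧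
      (∀ i, p ≤ i → t.S i .all → (σ i ≠ i → R σ (nm i) = R σ (nm (σ i))) ∧
        (σ i = i → ∀ j < i, R σ (nm i) ≠ R σ (nm j))) ∧
      (∀ σ', t.Valid σ' → ∀ i, p ≤ i → i < Q.length →
        (∀ j ≤ i, t.S j .all → σ j = σ' j) → R σ (nm i) = R σ' (nm i)) := by
  induction Q₂ with
  | nil =>
    intro p ρ hp hpl h
    rw [List.drop_eq_nil_iff] at hp
    refine ⟨fun _ => ρ, fun σ hσ => ⟨fun _ _ => rfl, h, fun i hi hS => ?_, fun _ _ _ _ _ _ => rfl⟩⟩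
    obtain ⟨hi', _⟩ := (hr.all_iff i).1 hS
    omega
  | cons z Q₃ ih =>
    intro p ρ hp hpl h
    have hlt : p < Q.length := by
      by_contra hcon
      rw [List.drop_eq_nil_of_le (by omega)] at hp
      exact List.cons_ne_nil _ _ hp.symm
    rw [List.drop_eq_getElem_cons hlt] at hp
    obtain ⟨hz, hQ₃⟩ := List.cons.inj hp
    obtain ⟨qq, x⟩ := z
    have hx : x = nm p := by rw [hr.nm_eq p hlt, hz]
    have hne : ∀ j < p, nm j ≠ nm p := fun j hj h' => by
      have := hr.inj j (by omega) p hlt h'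
      omega
    cases qq with
    | ex =>
      obtain ⟨a, ha⟩ := h
      obtain ⟨R, hR⟩ := ih (p + 1) _ hQ₃ hlt ha
      refine ⟨R, fun σ hσ => ?_⟩
      obtain ⟨h1, h2, h3, h4⟩ := hR σ hσ
      refine ⟨fun j hj => ?_, h2, fun i hi hS => ?_, fun σ' hσ' i hi hi' hag => ?_⟩
      · rw [h1 j (by omega), hx, Function.update_of_ne (hne j hj)]
      · refine h3 i (lt_of_le_of_ne hi ?_) hS
        rintro rfl
        obtain ⟨_, h'⟩ := (hr.all_iff p).1 hS
        rw [hz] at h'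
        exact Quant.noConfusion h'
      · rcases eq_or_lt_of_le hi with rfl | hi
        · rw [h1 p (by omega), (hR σ' hσ').1 p (by omega)]
        · exact h4 σ' hσ' i hi hi' hag
    | all =>
      choose R hR using fun a => ih (p + 1) _ hQ₃ hlt (h a)
      obtain ⟨fr, hfr⟩ := exists_fresh (fun j => ρ (nm j)) p
      have hSp : t.S p .all := (hr.all_iff p).2 ⟨hlt, by rw [hz]⟩
      -- The universal move depends on `σ p` and the values played so far only. Patterns that agree
      -- at `p` thus enter the same continuation, which gives the last clause.
      set val : (ℕ → ℕ) → ℕ := fun σ => if σ p = p then fr else ρ (nm (σ p)) with hval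
      refine ⟨fun σ => R (val σ) σ, fun σ hσ => ?_⟩
      obtain ⟨h1, h2, h3, h4⟩ := hR (val σ) σ hσ
      have h1' : ∀ j < p, R (val σ) σ (nm j) = ρ (nm j) := fun j hj => by
        rw [h1 j (by omega), hx, Function.update_of_ne (hne j hj)]
      have h1p : R (val σ) σ (nm p) = val σ := by
        rw [h1 p (by omega), hx, Function.update_self]
      refine ⟨h1', h2, fun i hi hS => ?_, fun σ' hσ' i hi hi' hag => ?_⟩
      · rcases eq_or_lt_of_le hi with rfl | hi
        · refine ⟨fun hne' => ?_, fun heq j hj => ?_⟩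
          · have := hσ p (hlt.trans_le hr.le)
            simp only
            rw [h1p, h1' _ (by omega), hval]
            simp [hne']
          · simp only
            rw [h1p, h1' _ hj, hval]
            simpa [heq] using hfr j hj
        · exact h3 i hi hS
      · have hv : val σ = val σ' := by simp only [hval, hag p hi hSp]
        simp only
        rw [← hv]
        rcases eq_or_lt_of_le hi with rfl | hi
        · rw [h1p, (hR (val σ) σ' hσ').1 p (by omega), hx, Function.update_self]
        · exact h4 σ' hσ' i hi hi' hag

/-- A sentence with a refutation is false. -/
theorem not_holds (hr : t.Represents nm Q M) {N : ℕ} {sig : ℕ → ℕ → ℕ} {rk : ℕ → ℕ → ℕ → ℕ}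
    (h : t.Refut N sig rk) (ρ : Var → ℕ) : ¬ Holds M Q ρ := by
  intro hh
  obtain ⟨R, hR⟩ := hr.exists_plays Q 0 ρ rfl (Nat.zero_le _) hh
  obtain ⟨hv, hj, s, hs, x, hx, b, hb, hSx, hxx, hrk⟩ := h
  have hv' : ∀ s < N, t.Valid (sig s) := hv
  have hql : ∀ {a}, t.IsQuant a → a < Q.length := by
    rintro a (h | h)
    exacts [((hr.ex_iff a).1 h).1, ((hr.all_iff a).1 h).1]
  -- Ranks decrease along justifications, across contexts too, so strong induction on the rank turns
  -- each certified equality into a true one in the play for its context.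
  have key : ∀ n s, s < N → ∀ a < t.m, ∀ b < t.m, rk s a b = n → 0 < n →
      R (sig s) (nm a) = R (sig s) (nm b) := by
    intro n
    induction n using Nat.strong_induction_on with
    | _ n ih =>
    intro s hs a ha b hb hn h0
    obtain ⟨-, hsat, hall, -⟩ := hR _ (hv' s hs)
    obtain ⟨hs1, hs2⟩ := (hr.sat_iff _).1 hsat
    rcases hj s hs a ha b hb (by omega) with h | h | ⟨c, hc, h, h'⟩ | h | h |
      ⟨c, hc, h1, h2, rfl, rfl, h5⟩ | ⟨h1, h2, s', h3, h4, h5⟩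
    · rw [(hr.same_iff a ha b hb).1 h]
    · exact (ih _ (by omega) s hs b hb a ha rfl h.1).symm
    · exact (ih _ (by omega) s hs a ha c hc rfl h.1).trans
        (ih _ (by omega) s hs c hc b hb rfl h'.1)
    · obtain ⟨h, rfl⟩ := h
      by_cases hne : sig s a = a
      · rw [hne]
      · exact (hall a (Nat.zero_le _) h).1 hne
    · obtain ⟨h, h', rfl⟩ := h
      exact hs1 a h h'
    · exact hs2 c h1 h2 (ih _ (by omega) s hs c hc (c + 1) (hr.and_lt c h1) rfl h5.1)
    · have hab := ih _ (by omega) s' h3 a ha b hb rfl h4.1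
      have e1 := (hR _ (hv' s hs)).2.2.2 _ (hv' s' h3) a (Nat.zero_le _) (hql h1)
        (fun j hj hS => h5 j (by omega) hS (.inl (lev_mono hj)))
      have e2 := (hR _ (hv' s hs)).2.2.2 _ (hv' s' h3) b (Nat.zero_le _) (hql h2)
        (fun j hj hS => h5 j (by omega) hS (.inr (lev_mono hj)))
      rw [e1, e2, hab]
  exact ((hR _ (hv' s hs)).2.2.1 x (Nat.zero_le _) hSx).2 hxx b hb
    (key _ s hs x hx b (by omega) rfl hrk)

/-- If no contradiction is derivable, then the existential player wins by playing equal values only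
where equality is derivable. -/
theorem holds_of_consistent (hr : t.Represents nm Q M)
    (hcons : ∀ σ, t.Valid σ → ∀ x, t.S x .all → σ x = x → ∀ b < x, ¬ t.Der σ x b)
    (Q₂ : List (Quant × Var)) :
    ∀ (p : ℕ) (ρ : Var → ℕ) (σ : ℕ → ℕ), Q.drop p = Q₂ → p ≤ Q.length → t.Valid σ →
    (∀ τ, t.Valid τ → (∀ i < p, t.S i .all → τ i = σ i) → ∀ i < p, ∀ j < p,
      (ρ (nm i) = ρ (nm j) ↔ t.Der τ i j)) → Holds M Q₂ ρ := by
  have hex_all : ∀ i, t.S i .ex → ¬ t.S i .all := fun i h h' => by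
    obtain ⟨_, h⟩ := (hr.ex_iff i).1 h
    obtain ⟨_, h'⟩ := (hr.all_iff i).1 h'
    rw [h] at h'
    exact Quant.noConfusion h'
  have hq : ∀ i < Q.length, t.IsQuant i := fun i hi => by
    rcases hqi : Q[i].1 with _ | _
    exacts [.inl ((hr.ex_iff i).2 ⟨hi, hqi⟩), .inr ((hr.all_iff i).2 ⟨hi, hqi⟩)]
  have hrefl : ∀ τ, ∀ i < t.m, t.Der τ i i := fun τ i hi =>
    .of_same hi hi ((hr.same_iff i hi i hi).2 rfl)
  have hle := hr.le
  induction Q₂ with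
  | nil =>
    intro p ρ σ hp hpl hσ hinv
    rw [List.drop_eq_nil_iff] at hp
    obtain rfl : p = Q.length := by omega
    have hinv' := hinv σ hσ fun _ _ _ => rfl
    have hder : ∀ a < t.m, ∀ b < t.m, (ρ (nm a) = ρ (nm b) ↔ t.Der σ a b) := by
      intro a ha b hb
      obtain ⟨i, hi, hia⟩ := hr.closed a ha
      obtain ⟨j, hj, hjb⟩ := hr.closed b hb
      have h1 : t.Der σ i a :=
        .of_same (by omega) ha ((hr.same_iff i (by omega) a ha).2 hia)
      have h2 : t.Der σ j b :=
        .of_same (by omega) hb ((hr.same_iff j (by omega) b hb).2 hjb)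
      rw [← hia, ← hjb, hinv' i hi j hj]
      exact ⟨fun h => h1.symm.trans (h.trans h2), fun h => h1.trans (h.trans h2.symm)⟩
    show ∀ C ∈ M, C.Sat ρ
    refine (hr.sat_iff ρ).2 ⟨fun a h h' => ?_, fun a h h' heq => ?_⟩
    · have := hr.and_lt a h
      exact (hder a (by omega) _ this).2 (.of_eq this h h')
    · have := hr.imp_lt a h h'
      exact (hder _ (by omega) _ this).2 (.of_imp this h h'
        ((hder a (by omega) _ (by omega)).1 heq))
  | cons z Q₃ ih =>
    intro p ρ σ hp hpl hσ hinv
    have hlt : p < Q.length := by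
      by_contra hcon
      rw [List.drop_eq_nil_of_le (by omega)] at hp
      exact List.cons_ne_nil _ _ hp.symm
    rw [List.drop_eq_getElem_cons hlt] at hp
    obtain ⟨hz, hQ₃⟩ := List.cons.inj hp
    obtain ⟨qq, x⟩ := z
    have hx : x = nm p := by rw [hr.nm_eq p hlt, hz]
    have hne : ∀ j < p, nm j ≠ nm p := fun j hj h' => by
      have := hr.inj j (by omega) p hlt h'
      omega
    -- the invariant after giving the value `v` to the next variable
    have hstep : ∀ (v : ℕ) (τ : ℕ → ℕ), (∀ i < p, ∀ j < p, (ρ (nm i) = ρ (nm j) ↔ t.Der τ i j)) →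
        (∀ j < p, (v = ρ (nm j) ↔ t.Der τ p j)) → ∀ i < p + 1, ∀ j < p + 1,
        (Function.update ρ x v (nm i) = Function.update ρ x v (nm j) ↔ t.Der τ i j) := by
      intro v τ h1 h2 i hi j hj
      rw [hx]
      rcases eq_or_lt_of_le (Nat.lt_succ_iff.1 hi) with rfl | hi <;>
        rcases eq_or_lt_of_le (Nat.lt_succ_iff.1 hj) with rfl | hj
      · exact iff_of_true rfl (hrefl _ _ (by omega))
      · rw [Function.update_self, Function.update_of_ne (hne j hj)]
        exact h2 j hj
      · rw [Function.update_self, Function.update_of_ne (hne i hi), eq_comm, h2 i hi]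
        exact ⟨.symm, .symm⟩
      · rw [Function.update_of_ne (hne i hi), Function.update_of_ne (hne j hj)]
        exact h1 i hi j hj
    obtain ⟨fr, hfr⟩ := exists_fresh (fun j => ρ (nm j)) p
    cases qq with
    | ex =>
      have hSp : t.S p .ex := (hr.ex_iff p).2 ⟨hlt, by rw [hz]⟩
      -- Copy a value to which equality is derivable; if there is none, play a fresh value.
      have hval : ∃ v, ∀ j < p, (v = ρ (nm j) ↔ t.Der σ p j) := by
        by_cases hc : ∃ c < p, t.Der σ p c
        · obtain ⟨c, hc, hd⟩ := hc
          refine ⟨ρ (nm c), fun j hj => ?_⟩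
          rw [hinv σ hσ (fun _ _ _ => rfl) c hc j hj]
          exact ⟨hd.trans, hd.symm.trans⟩
        · exact ⟨fr, fun j hj => iff_of_false (hfr j hj) fun hd => hc ⟨j, hj, hd⟩⟩
      obtain ⟨v, hv⟩ := hval
      -- The invariant ranges over all valid patterns `τ` that agree with `σ` so far, as later
      -- universal moves are still open. The value was chosen for `σ`; the transfer rule makes it
      -- right for all such `τ`, because the universal variables relevant for `p` and `j` have
      -- already been played.
      refine ⟨v, ih (p + 1) _ σ hQ₃ hlt hσ fun τ hτ hag => ?_⟩
      refine hstep v τ (hinv τ hτ fun i hi => hag i (by omega)) fun j hj => ?_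
      have hagree : ∀ i, t.S i .all → t.lev i ≤ t.lev p ∨ t.lev i ≤ t.lev j → σ i = τ i := by
        intro i hi hl
        have hl' : t.lev i ≤ t.lev p := hl.elim id fun h => h.trans (lev_mono hj.le)
        have hip : i ≤ p := by
          by_contra hcon
          exact (lev_lt (hex_all p hSp) hi (Nat.lt_of_not_le hcon)).not_ge hl'
        exact (hag i (by omega) hi).symm
      rw [hv j hj]
      have hqj := hq j (by omega)
      exact ⟨.transfer (.inl hSp) hqj hσ fun i _ hi hl => (hagree i hi hl).symm,
        .transfer (.inl hSp) hqj hτ fun i _ hi hl => hagree i hi hl⟩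
    | all =>
      have hSp : t.S p .all := (hr.all_iff p).2 ⟨hlt, by rw [hz]⟩
      intro v
      -- The entry of the pattern is read off from the actual move: an earlier variable with this
      -- value, or `p` itself if the value is new.
      have hsel : ∃ c ≤ p, (c < p ∧ v = ρ (nm c)) ∨ (c = p ∧ ∀ j < p, v ≠ ρ (nm j)) := by
        by_cases hc : ∃ c < p, v = ρ (nm c)
        · obtain ⟨c, hc, hv⟩ := hc
          exact ⟨c, hc.le, .inl ⟨hc, hv⟩⟩
        · exact ⟨p, le_rfl, .inr ⟨rfl, fun j hj h => hc ⟨j, hj, h⟩⟩⟩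
      obtain ⟨c, hcp, hc⟩ := hsel
      have hσ' : t.Valid (Function.update σ p c) := fun i hi => by
        rcases eq_or_ne i p with rfl | hne
        · rwa [Function.update_self]
        · rw [Function.update_of_ne hne]; exact hσ i hi
      refine ih (p + 1) _ _ hQ₃ hlt hσ' fun τ hτ hag => ?_
      have hτp : τ p = c := by rw [hag p (by omega) hSp, Function.update_self]
      have hold := hinv τ hτ fun i hi hS => by
        rw [hag i (by omega) hS, Function.update_of_ne hi.ne]
      refine hstep v τ hold fun j hj => ?_
      rcases hc with ⟨hc, rfl⟩ | ⟨rfl, hv⟩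
      · have hd : t.Der τ p c := hτp ▸ Der.of_all (by omega) hSp hτ
        rw [hold c hc j hj]
        exact ⟨hd.trans, hd.symm.trans⟩
      -- The only use of consistency: a fresh universal value is not derivably equal to an earlier
      -- variable.
      · exact iff_of_false (hv j hj) (hcons τ hτ c hSp hτp j hj)

theorem exists_contradiction (hr : t.Represents nm Q M) {ρ : Var → ℕ} (h : ¬ Holds M Q ρ) :
    ∃ σ, t.Valid σ ∧ ∃ x, t.S x .all ∧ σ x = x ∧ ∃ b < x, t.Der σ x b := by
  by_contra hcon
  push Not at hcon
  exact h (hr.holds_of_consistent hcon Q 0 ρ id rfl (Nat.zero_le _) (fun _ _ => le_rfl)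
    fun _ _ _ i hi => absurd hi (Nat.not_lt_zero i))

end Represents

end Tokens

end EqQCSP

namespace EqQCSP

namespace Tokens

variable {t : Tokens}

/-! ### Refutations of polynomial size -/

variable (t) in
open Classical in
/-- The least height of a derivation, and `0` if there is none. -/
noncomputable def ht (σ : ℕ → ℕ) (a b : ℕ) : ℕ :=
  if h : t.Der σ a b then Nat.find h else 0

theorem ht_pos {σ : ℕ → ℕ} {a b : ℕ} : 0 < t.ht σ a b ↔ t.Der σ a b := by
  classical
  unfold ht
  split_ifs with h
  · refine iff_of_true (Nat.pos_of_ne_zero fun h0 => ?_) h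
    have := Nat.find_spec h
    rw [h0] at this
    exact this
  · simpa using h

theorem derH_ht {σ : ℕ → ℕ} {a b : ℕ} (h : t.Der σ a b) : t.DerH (t.ht σ a b) σ a b := by
  classical
  unfold ht
  rw [dif_pos h]
  exact Nat.find_spec h

theorem ht_le {σ : ℕ → ℕ} {a b n : ℕ} (h : t.DerH n σ a b) : t.ht σ a b ≤ n := by
  classical
  unfold ht
  rw [dif_pos ⟨n, h⟩]
  exact Nat.find_min' _ h

variable (t) in
/-- The patterns that prescribe the same as `σ` for the universal variables up to level `l`. -/
def level (l : ℕ) (σ : ℕ → ℕ) : Set (ℕ → ℕ) :=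
  {τ | t.Valid τ ∧ ∀ i < t.m, t.S i .all → t.lev i ≤ l → σ i = τ i}

theorem level_eq {l : ℕ} {σ τ : ℕ → ℕ} (h : τ ∈ t.level l σ) : t.level l τ = t.level l σ := by
  ext υ
  refine and_congr_right fun _ => forall₄_congr fun i hi hS hl => ?_
  rw [h.2 i hi hS hl]

variable (t) in
/-- A pattern among those of a set with a shortest derivation of the equality of `a` and `b`. -/
theorem exists_best (X : Set (ℕ → ℕ)) (a b : ℕ) : ∃ τ, (X.Nonempty → τ ∈ X) ∧
    ∀ υ ∈ X, t.Der υ a b → t.Der τ a b ∧ t.ht τ a b ≤ t.ht υ a b := by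
  by_cases h : {υ ∈ X | t.Der υ a b}.Nonempty
  · refine ⟨Function.argminOn (fun υ => t.ht υ a b) _ h, fun _ => ?_, fun υ hυ hd => ?_⟩
    · exact (Function.argminOn_mem (fun υ => t.ht υ a b) _ h).1
    · exact ⟨(Function.argminOn_mem (fun υ => t.ht υ a b) _ h).2,
        Function.argminOn_le (fun υ => t.ht υ a b) {υ ∈ X | t.Der υ a b} ⟨hυ, hd⟩⟩
  · rcases X.eq_empty_or_nonempty with rfl | ⟨τ, hτ⟩
    · exact ⟨id, by simp, fun υ hυ => hυ.elim⟩
    · exact ⟨τ, fun _ => hτ, fun υ hυ hd => (h ⟨υ, hυ, hd⟩).elim⟩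

variable (t) in
/-- A choice of patterns as in `exists_best`. -/
noncomputable def best (X : Set (ℕ → ℕ)) (a b : ℕ) : ℕ → ℕ := (t.exists_best X a b).choose

variable (t) in
open Classical in
/-- The patterns used in a refutation: besides `σ₀` those with shortest derivations, chosen for the
levels below `l`. -/
noncomputable def pats (σ₀ : ℕ → ℕ) : ℕ → Finset (ℕ → ℕ)
  | 0 => {σ₀}
  | l + 1 => pats σ₀ l ∪ (pats σ₀ l ×ˢ (Finset.range t.m ×ˢ Finset.range t.m)).image
      fun z => t.best (t.level l z.1) z.2.1 z.2.2

/-- Each round adds at most one pattern for each old pattern and pair of tokens. For a fixed number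
of rounds the bound is polynomial. -/
theorem card_pats_le (σ₀ : ℕ → ℕ) {n : ℕ} (hn : t.m ≤ n) (l : ℕ) :
    (t.pats σ₀ l).card ≤ (1 + n * n) ^ l := by
  classical
  induction l with
  | zero => simp [pats]
  | succ l ih =>
    refine (Finset.card_union_le _ _).trans ((Nat.add_le_add_left Finset.card_image_le _).trans ?_)
    rw [Finset.card_product, Finset.card_product, Finset.card_range, pow_succ]
    calc (t.pats σ₀ l).card + (t.pats σ₀ l).card * (t.m * t.m)
        = (t.pats σ₀ l).card * (1 + t.m * t.m) := by ring
      _ ≤ _ := by gcongr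

theorem pats_mono (σ₀ : ℕ → ℕ) {l l' : ℕ} (h : l ≤ l') : t.pats σ₀ l ⊆ t.pats σ₀ l' := by
  classical
  induction h with
  | refl => exact subset_rfl
  | step _ ih => exact ih.trans Finset.subset_union_left

theorem best_mem {l : ℕ} {σ : ℕ → ℕ} (h : t.Valid σ) (a b : ℕ) :
    t.best (t.level l σ) a b ∈ t.level l σ :=
  (t.exists_best _ a b).choose_spec.1 ⟨σ, h, fun _ _ _ _ => rfl⟩

theorem valid_of_mem_pats {σ₀ : ℕ → ℕ} (h₀ : t.Valid σ₀) {l : ℕ} :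
    ∀ {τ}, τ ∈ t.pats σ₀ l → t.Valid τ := by
  classical
  induction l with
  | zero => intro τ h; rw [pats, Finset.mem_singleton] at h; rwa [h]
  | succ l ih =>
    intro τ h
    rcases Finset.mem_union.1 h with h | h
    · exact ih h
    · obtain ⟨z, hz, rfl⟩ := Finset.mem_image.1 h
      exact (best_mem (ih (Finset.mem_product.1 hz).1) _ _).1

/-- A pattern added after round `l` agrees up to level `l` with the one it was chosen for. Tracing
back, every later pattern has a representative of its level-`l` class already in round `l`. -/
theorem exists_mem_pats_level {σ₀ : ℕ → ℕ} (h₀ : t.Valid σ₀) {l l' : ℕ} (hl : l ≤ l') :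
    ∀ {τ}, τ ∈ t.pats σ₀ l' → ∃ τ' ∈ t.pats σ₀ l, τ' ∈ t.level l τ := by
  classical
  induction hl with
  | refl => exact fun {τ} h => ⟨τ, h, valid_of_mem_pats h₀ h, fun _ _ _ _ => rfl⟩
  | step hl ih =>
    rename_i l''
    intro τ h
    rcases Finset.mem_union.1 h with h | h
    · exact ih h
    · obtain ⟨z, hz, rfl⟩ := Finset.mem_image.1 h
      have hz1 := (Finset.mem_product.1 hz).1
      obtain ⟨τ', hτ', hτ''⟩ := ih hz1
      have hb := best_mem (l := l'') (valid_of_mem_pats h₀ hz1) z.2.1 z.2.2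
      exact ⟨τ', hτ', hτ''.1, fun i hi hS hli =>
        (hb.2 i hi hS (hli.trans hl)).symm.trans (hτ''.2 i hi hS hli)⟩

/-- Derivations of minimal height can be found among the chosen patterns. -/
theorem exists_mem_pats {σ₀ : ℕ → ℕ} (h₀ : t.Valid σ₀) {k l : ℕ} (hl : l ≤ k) {τ υ : ℕ → ℕ}
    (hτ : τ ∈ t.pats σ₀ (k + 1)) (hυ : υ ∈ t.level l τ) {a b : ℕ} (hd : t.Der υ a b) :
    ∃ τ' ∈ t.pats σ₀ (k + 1), τ' ∈ t.level l τ ∧ t.Der τ' a b ∧ t.ht τ' a b ≤ t.ht υ a b := by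
  classical
  -- The representative `σ` spans the same class as `τ`, and the best pattern of this class was
  -- added in round `l + 1`, which is at most `k + 1`.
  obtain ⟨σ, hσ, hσ'⟩ := exists_mem_pats_level h₀ (show l ≤ k + 1 by omega) hτ
  have hb := best_mem (l := l) hσ'.1 a b
  rw [← level_eq hσ'] at hυ ⊢
  refine ⟨t.best (t.level l σ) a b, pats_mono σ₀ (show l + 1 ≤ k + 1 by omega) ?_, hb,
    (t.exists_best _ a b).choose_spec.2 υ hυ hd⟩
  exact Finset.mem_union_right _ (Finset.mem_image.2 ⟨(σ, a, b), Finset.mem_product.2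
    ⟨hσ, Finset.mem_product.2 ⟨Finset.mem_range.2 hd.lt_left, Finset.mem_range.2 hd.lt_right⟩⟩, rfl⟩)

/-- The last step of a derivation of least height is reused. For a transfer, the source pattern is
replaced by a chosen one that agrees up to the larger level of `a` and `b` and whose derivation is
no higher, so heights still decrease. -/
theorem just_of_mem_pats {k : ℕ} (hk : ∀ a, t.IsQuant a → t.lev a ≤ k) {σ₀ : ℕ → ℕ}
    (h₀ : t.Valid σ₀) {τ : ℕ → ℕ} (hτ : τ ∈ t.pats σ₀ (k + 1)) {a b : ℕ} (hd : 0 < t.ht τ a b) :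
    t.Just (· ∈ t.pats σ₀ (k + 1)) id
      (fun τ' a' b' => 0 < t.ht τ' a' b' ∧ t.ht τ' a' b' < t.ht τ a b) τ a b := by
  have hh := derH_ht (ht_pos.1 hd)
  obtain ⟨n, hn⟩ : ∃ n, t.ht τ a b = n + 1 := ⟨t.ht τ a b - 1, by omega⟩
  rw [hn] at hh ⊢
  have hlt : ∀ {τ' a' b'}, t.DerH n τ' a' b' → 0 < t.ht τ' a' b' ∧ t.ht τ' a' b' < n + 1 :=
    fun h => ⟨ht_pos.2 ⟨n, h⟩, Nat.lt_succ_of_le (ht_le h)⟩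
  obtain ⟨ha, hb, h | h | ⟨c, hc, h, h'⟩ | h | h | ⟨c, hc, h1, h2, h3, h4, h5⟩ |
    ⟨h1, h2, s', h3, h4, h5⟩⟩ := hh
  · exact .inl h
  · exact .inr (.inl (hlt h))
  · exact .inr (.inr (.inl ⟨c, hc, hlt h, hlt h'⟩))
  · exact .inr (.inr (.inr (.inl h)))
  · exact .inr (.inr (.inr (.inr (.inl h))))
  · exact .inr (.inr (.inr (.inr (.inr (.inl ⟨c, hc, h1, h2, h3, h4, hlt h5⟩)))))
  · obtain ⟨τ', hτ', hl, hd', hle⟩ := exists_mem_pats h₀ (max_le (hk a h1) (hk b h2)) hτ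
      (υ := s') ⟨h3, fun i hi hS hli => h5 i hi hS (le_max_iff.1 hli)⟩ ⟨n, h4⟩
    exact .inr (.inr (.inr (.inr (.inr (.inr ⟨h1, h2, τ', hτ', ⟨ht_pos.2 hd',
      hle.trans_lt (hlt h4).2⟩, fun i hi hS hli => hl.2 i hi hS (le_max_iff.2 hli)⟩)))))

theorem exists_enum {α : Type} (S : Finset α) (hS : S.Nonempty) {M : ℕ} (hM : S.card ≤ M) :
    ∃ e : ℕ → α, (∀ s, e s ∈ S) ∧ ∀ x ∈ S, ∃ s < M, e s = x := by
  obtain ⟨x₀, h₀⟩ := hS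
  refine ⟨fun s => if h : s < S.card then (S.equivFin.symm ⟨s, h⟩).1 else x₀, fun s => ?_,
    fun x hx => ⟨(S.equivFin ⟨x, hx⟩).1, (S.equivFin ⟨x, hx⟩).2.trans_le hM, ?_⟩⟩
  · dsimp only
    split_ifs
    exacts [(S.equivFin.symm _).2, h₀]
  · simp

open Classical in
/-- A rank function can be replaced by one whose values are at most the number of arguments. -/
theorem exists_compress {ι : Type} (I : Finset ι) (f : ι → ℕ) : ∃ r : ι → ℕ,
    (∀ i, r i ≤ I.card) ∧ (∀ i, 0 < r i → 0 < f i) ∧ (∀ i ∈ I, 0 < f i → 0 < r i) ∧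
    ∀ i, ∀ j ∈ I, f i < f j → r i < r j := by
  -- Counting the arguments in `I` with positive value not above `f i` keeps the strict order and
  -- positivity on `I`, however large the values are.
  refine ⟨fun i => {j ∈ I | 0 < f j ∧ f j ≤ f i}.card, fun i => Finset.card_filter_le _ _,
    fun i h => ?_, fun i hi h => ?_, fun i j hj h => ?_⟩
  · obtain ⟨j, hj⟩ := Finset.card_pos.1 h
    have := (Finset.mem_filter.1 hj).2
    omega
  · exact Finset.card_pos.2 ⟨i, Finset.mem_filter.2 ⟨hi, h, le_rfl⟩⟩
  · refine Finset.card_lt_card (Finset.ssubset_iff_of_subset ?_ |>.2 ⟨j, ?_, ?_⟩)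
    · exact Finset.monotone_filter_right _ fun _ _ h' => ⟨h'.1, h'.2.trans h.le⟩
    · exact Finset.mem_filter.2 ⟨hj, by omega, le_rfl⟩
    · simp only [Finset.mem_filter, not_and]
      omega

/-- The contexts enumerate the chosen patterns and the ranks are compressed heights; the compression
keeps the ranks short enough to be written in unary. -/
theorem exists_refut {k : ℕ} (hk : ∀ a, t.IsQuant a → t.lev a ≤ k)
    (hq : ∀ a, t.S a .all → a < t.m) {n : ℕ} (hn : t.m ≤ n)
    (h : ∃ σ, t.Valid σ ∧ ∃ x, t.S x .all ∧ σ x = x ∧ ∃ b < x, t.Der σ x b) :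
    ∃ sig rk, t.Refut ((1 + n * n) ^ (k + 1)) sig rk ∧
      ∀ s a b, rk s a b ≤ (1 + n * n) ^ (k + 1) * (n * n) := by
  classical
  obtain ⟨σ₀, h₀, x, hx, hxx, b, hb, hd⟩ := h
  set M := (1 + n * n) ^ (k + 1) with hM
  have hmem₀ : σ₀ ∈ t.pats σ₀ (k + 1) := pats_mono σ₀ (Nat.zero_le _) (by simp [pats])
  obtain ⟨e, he, he'⟩ := exists_enum (t.pats σ₀ (k + 1)) ⟨σ₀, hmem₀⟩ (card_pats_le σ₀ hn (k + 1))
  set I := Finset.range M ×ˢ (Finset.range t.m ×ˢ Finset.range t.m) with hI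
  obtain ⟨r, hr1, hr2, hr3, hr4⟩ := exists_compress I fun z => t.ht (e z.1) z.2.1 z.2.2
  have hmemI : ∀ {s a b}, s < M → a < t.m → b < t.m → (s, a, b) ∈ I := fun h1 h2 h3 => by
    simp [hI, h1, h2, h3]
  refine ⟨e, fun s a b => r (s, a, b), ⟨fun s _ i hi => valid_of_mem_pats h₀ (he s) i hi,
    fun s hs a ha b hb hpos => ?_, ?_⟩, fun s a b => (hr1 _).trans ?_⟩
  · have hlt : ∀ {s' a' b'}, s' < M → 0 < t.ht (e s') a' b' ∧
        t.ht (e s') a' b' < t.ht (e s) a b → 0 < r (s', a', b') ∧ r (s', a', b') < r (s, a, b) :=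
      fun {s' a' b'} hs' h => ⟨hr3 _ (hmemI hs' (ht_pos.1 h.1).lt_left (ht_pos.1 h.1).lt_right) h.1,
        hr4 (s', a', b') (s, a, b) (hmemI hs ha hb) h.2⟩
    have hj := just_of_mem_pats hk h₀ (he s) (hr2 _ hpos)
    rcases hj with h | h | ⟨c, hc, h, h'⟩ | h | h | ⟨c, hc, h1, h2, h3, h4, h5⟩ |
      ⟨h1, h2, τ', h3, h4, h5⟩
    · exact .inl h
    · exact .inr (.inl (hlt hs h))
    · exact .inr (.inr (.inl ⟨c, hc, hlt hs h, hlt hs h'⟩))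
    · exact .inr (.inr (.inr (.inl h)))
    · exact .inr (.inr (.inr (.inr (.inl h))))
    · exact .inr (.inr (.inr (.inr (.inr (.inl ⟨c, hc, h1, h2, h3, h4, hlt hs h5⟩)))))
    · obtain ⟨s', hs', rfl⟩ := he' τ' h3
      exact .inr (.inr (.inr (.inr (.inr (.inr ⟨h1, h2, s', hs', hlt hs' h4, h5⟩)))))
  · obtain ⟨s, hs, rfl⟩ := he' σ₀ hmem₀
    exact ⟨s, hs, x, hq x hx, b, hb, hx, hxx,
      hr3 _ (hmemI hs (hq x hx) hd.lt_right) (ht_pos.2 hd)⟩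
  · rw [hI, Finset.card_product, Finset.card_product, Finset.card_range, Finset.card_range]
    gcongr

/-- Whether there is a refutation depends on the values for tokens only. -/
theorem Refut.congr {M : ℕ} {sig sig' : ℕ → ℕ → ℕ} {rk rk' : ℕ → ℕ → ℕ → ℕ}
    (h : t.Refut M sig rk) (hsig : ∀ s < M, ∀ i < t.m, sig' s i = sig s i)
    (hrk : ∀ s < M, ∀ a < t.m, ∀ b < t.m, rk' s a b = rk s a b) : t.Refut M sig' rk' := by
  obtain ⟨hv, hj, s, hs, x, hx, b, hb, hSx, hxx, hr⟩ := h
  refine ⟨fun s hs i hi => by rw [hsig s hs i hi]; exact hv s hs i hi, fun s hs a ha b hb hpos => ?_,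
    s, hs, x, hx, b, hb, hSx, by rwa [hsig s hs x hx], by rwa [hrk s hs x hx b (hb.trans hx)]⟩
  rw [hrk s hs a ha b hb] at hpos ⊢
  have hR : ∀ s' < M, ∀ a' < t.m, ∀ b' < t.m, (0 < rk s' a' b' ∧ rk s' a' b' < rk s a b) →
      0 < rk' s' a' b' ∧ rk' s' a' b' < rk s a b := fun s' hs' a' ha' b' hb' h => by
    rwa [hrk s' hs' a' ha' b' hb']
  rcases hj s hs a ha b hb hpos with h | h | ⟨c, hc, h, h'⟩ | h | h | ⟨c, hc, h1, h2, h3, h4, h5⟩ |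
    ⟨h1, h2, s', h3, h4, h5⟩
  · exact .inl h
  · exact .inr (.inl (hR s hs b hb a ha h))
  · exact .inr (.inr (.inl ⟨c, hc, hR s hs a ha c hc h, hR s hs c hc b hb h'⟩))
  · exact .inr (.inr (.inr (.inl (by rwa [hsig s hs a ha]))))
  · exact .inr (.inr (.inr (.inr (.inl h))))
  · exact .inr (.inr (.inr (.inr (.inr (.inl ⟨c, hc, h1, h2, h3, h4,
      hR s hs c hc (c + 1) (by omega) h5⟩)))))
  · refine .inr (.inr (.inr (.inr (.inr (.inr ⟨h1, h2, s', h3, hR s' h3 a ha b hb h4,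
      fun i hi hS hl => ?_⟩)))))
    rw [hsig s hs i hi, hsig s' h3 i hi]
    exact h5 i hi hS hl

end Tokens

end EqQCSP

namespace EqQCSP

/-! ### Sentences as sequences of tokens -/

/-- The tokens of a constraint. -/
def Constraint.toks : Constraint → List (Sym × Var)
  | eq x y => [(.and, x), (.eq, y)]
  | imp x y u v => [(.and, x), (.eq, y), (.imp, u), (.eq, v)]

/-- The tokens of a formula. -/
def Formula.toks (φ : Formula) : List (Sym × Var) :=
  φ.quants.map (fun p => (p.1.sym, p.2)) ++ φ.matrix.flatMap Constraint.toks

namespace Tokens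

/-- The token structure of a list of tokens. -/
def ofList (T : List (Sym × Var)) : Tokens where
  m := T.length
  S i s := ∃ v, T[i]? = some (s, v)
  same i j := ∀ (u : ℕ) (b : Bool), (∃ (s : Sym) (v : Var), T[i]? = some (s, v) ∧ v[u]? = some b) ↔
    ∃ (s : Sym) (v : Var), T[j]? = some (s, v) ∧ v[u]? = some b

theorem ofList_S_cons (p : Sym × Var) (T : List (Sym × Var)) (i : ℕ) (s : Sym) :
    (ofList (p :: T)).S (i + 1) s ↔ (ofList T).S i s := by
  simp [ofList]

theorem ofList_S_zero (a s : Sym) (x : Var) (T : List (Sym × Var)) :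
    (ofList ((a, x) :: T)).S 0 s ↔ a = s := by
  simp [ofList]

theorem lt_of_S {T : List (Sym × Var)} {i : ℕ} {s : Sym} (h : (ofList T).S i s) : i < T.length := by
  obtain ⟨v, h⟩ := h
  exact (List.getElem?_eq_some_iff.1 h).1

variable (t : Tokens)

/-- The matrix ends before the token `i`, or a new constraint starts there. -/
def EndAt (i : ℕ) : Prop := t.S i .and ∨ t.m ≤ i

/-- A constraint that starts at the token `i` is complete. -/
def ConstraintAt (i : ℕ) : Prop :=
  t.S i .and → t.S (i + 1) .eq ∧
    (t.EndAt (i + 2) ∨ t.S (i + 2) .imp ∧ t.S (i + 3) .eq ∧ t.EndAt (i + 4))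

/-- The sequence of symbols is that of a formula. -/
def Grammatical : Prop :=
  (t.IsQuant 0 ∨ t.EndAt 0) ∧
    ∀ i < t.m, (t.IsQuant i → t.IsQuant (i + 1) ∨ t.EndAt (i + 1)) ∧ t.ConstraintAt i

/-- The tokens are those of a sentence whose prefix has at most `k` blocks of universal
quantifiers. -/
def WellFormed (k : ℕ) : Prop :=
  t.Grammatical ∧
  (∀ i < t.m, ∀ j < t.m, t.IsQuant i → t.IsQuant j → t.same i j → i = j) ∧
  (∀ i < t.m, ∃ j < t.m, t.IsQuant j ∧ t.same i j) ∧
  t.lev t.m ≤ k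

variable {t} {p : Sym × Var} {T : List (Sym × Var)}

theorem endAt_cons {i : ℕ} : (ofList (p :: T)).EndAt (i + 1) ↔ (ofList T).EndAt i := by
  unfold EndAt
  rw [ofList_S_cons]
  simp [ofList]

theorem isQuant_cons {i : ℕ} : (ofList (p :: T)).IsQuant (i + 1) ↔ (ofList T).IsQuant i := by
  simp only [IsQuant, ofList_S_cons]

theorem constraintAt_cons {i : ℕ} :
    (ofList (p :: T)).ConstraintAt (i + 1) ↔ (ofList T).ConstraintAt i := by
  unfold ConstraintAt
  rw [ofList_S_cons, show i + 1 + 1 = (i + 1) + 1 from rfl, ofList_S_cons,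
    show i + 1 + 2 = (i + 2) + 1 from rfl, ofList_S_cons, endAt_cons,
    show i + 1 + 3 = (i + 3) + 1 from rfl, ofList_S_cons,
    show i + 1 + 4 = (i + 4) + 1 from rfl, endAt_cons]

theorem constraintAt_zero_of_ne {a : Sym} {x : Var} (h : a ≠ .and) :
    (ofList ((a, x) :: T)).ConstraintAt 0 := fun h' => (h ((ofList_S_zero _ _ _ _).1 h')).elim

theorem endAt_flatMap (M : List Constraint) : (ofList (M.flatMap Constraint.toks)).EndAt 0 := by
  cases M with
  | nil => exact .inr le_rfl
  | cons C M => cases C <;> exact .inl ⟨_, rfl⟩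

theorem constraintAt_flatMap (M : List Constraint) :
    ∀ i, (ofList (M.flatMap Constraint.toks)).ConstraintAt i := by
  induction M with
  | nil => rintro i ⟨v, hv⟩; simp at hv
  | cons C M ih =>
    have hend := endAt_flatMap M
    rw [List.flatMap_cons]
    intro i
    cases C with
    | eq x y =>
      rcases i with _ | _ | i
      · exact fun _ => ⟨⟨y, rfl⟩, .inl (endAt_cons.2 (endAt_cons.2 hend))⟩
      · exact constraintAt_cons.2 (constraintAt_zero_of_ne (by simp))
      · exact constraintAt_cons.2 (constraintAt_cons.2 (ih i))
    | imp x y u v =>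
      rcases i with _ | _ | _ | _ | i
      · exact fun _ => ⟨⟨y, rfl⟩, .inr ⟨⟨u, rfl⟩, ⟨v, rfl⟩,
          endAt_cons.2 (endAt_cons.2 (endAt_cons.2 (endAt_cons.2 hend)))⟩⟩
      · exact constraintAt_cons.2 (constraintAt_zero_of_ne (by simp))
      · exact constraintAt_cons.2 (constraintAt_cons.2 (constraintAt_zero_of_ne (by simp)))
      · exact constraintAt_cons.2 (constraintAt_cons.2 (constraintAt_cons.2
          (constraintAt_zero_of_ne (by simp))))
      · exact constraintAt_cons.2 (constraintAt_cons.2 (constraintAt_cons.2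
          (constraintAt_cons.2 (ih i))))

theorem not_isQuant_flatMap (M : List Constraint) (i : ℕ) :
    ¬ (ofList (M.flatMap Constraint.toks)).IsQuant i := by
  have : ∀ p ∈ M.flatMap Constraint.toks, p.1 ≠ .ex ∧ p.1 ≠ .all := by
    intro p hp
    obtain ⟨C, -, hC⟩ := List.mem_flatMap.1 hp
    cases C <;> simp only [Constraint.toks, List.mem_cons, List.not_mem_nil, or_false] at hC
    · rcases hC with rfl | rfl <;> simp
    · rcases hC with rfl | rfl | rfl | rfl <;> simp
  rintro (⟨v, h⟩ | ⟨v, h⟩)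
  · exact (this _ (List.mem_of_getElem? h)).1 rfl
  · exact (this _ (List.mem_of_getElem? h)).2 rfl

theorem grammatical_toks (φ : Formula) : (ofList φ.toks).Grammatical := by
  obtain ⟨Q, M⟩ := φ
  unfold Formula.toks
  simp only
  induction Q with
  | nil =>
    rw [List.map_nil, List.nil_append]
    exact ⟨.inr (endAt_flatMap M), fun i _ => ⟨fun h => (not_isQuant_flatMap M i h).elim,
      constraintAt_flatMap M i⟩⟩
  | cons q Q ih =>
    rw [List.map_cons, List.cons_append]
    have hq : q.1.sym = .ex ∨ q.1.sym = .all := by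
      rcases q.1 <;> simp [Quant.sym]
    refine ⟨.inl ?_, fun i hi => ?_⟩
    · rcases hq with h | h
      exacts [.inl ((ofList_S_zero _ _ _ _).2 h), .inr ((ofList_S_zero _ _ _ _).2 h)]
    · rcases i with _ | i
      · refine ⟨fun _ => ?_, constraintAt_zero_of_ne ?_⟩
        · rw [isQuant_cons, endAt_cons]
          exact ih.1
        · rcases hq with h | h <;> rw [h] <;> simp
      · rw [isQuant_cons, isQuant_cons, endAt_cons, constraintAt_cons]
        exact ih.2 i (Nat.lt_of_succ_lt_succ hi)

/-- The local conditions determine the first constraint and say that another one, or the end,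
follows; the rest is parsed by induction on the length. -/
theorem exists_matrix : ∀ (n : ℕ) (T : List (Sym × Var)), T.length ≤ n → (ofList T).EndAt 0 →
    (∀ i, (ofList T).ConstraintAt i) → ∃ M : List Constraint, M.flatMap Constraint.toks = T := by
  intro n
  induction n using Nat.strong_induction_on with
  | _ n ih =>
  intro T hT hend hcon
  rcases hend with h0 | h0
  · obtain ⟨h1, h2⟩ := hcon 0 h0
    rcases T with _ | ⟨⟨a, x⟩, _ | ⟨⟨b, y⟩, T⟩⟩
    · exact absurd (lt_of_S h0) (by simp)
    · exact absurd (lt_of_S h1) (by simp)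
    · simp only [Nat.zero_add] at h1
      rw [ofList_S_zero] at h0
      rw [ofList_S_cons, ofList_S_zero] at h1
      subst h0 h1
      rcases h2 with h2 | ⟨h2, h3, h4⟩
      · rw [Nat.zero_add, endAt_cons, endAt_cons] at h2
        obtain ⟨M, rfl⟩ := ih T.length (by simp at hT; omega) T le_rfl h2
          fun i => constraintAt_cons.1 (constraintAt_cons.1 (hcon (i + 2)))
        exact ⟨.eq x y :: M, rfl⟩
      · rcases T with _ | ⟨⟨a, u⟩, _ | ⟨⟨b, v⟩, T⟩⟩
        · exact absurd (lt_of_S h2) (by simp)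
        · exact absurd (lt_of_S h3) (by simp)
        · rw [Nat.zero_add, ofList_S_cons, ofList_S_cons, ofList_S_zero] at h2
          rw [Nat.zero_add, ofList_S_cons, ofList_S_cons, ofList_S_cons, ofList_S_zero] at h3
          rw [Nat.zero_add, endAt_cons, endAt_cons, endAt_cons, endAt_cons] at h4
          subst h2 h3
          obtain ⟨M, rfl⟩ := ih T.length (by simp at hT; omega) T le_rfl h4
            fun i => constraintAt_cons.1 (constraintAt_cons.1 (constraintAt_cons.1
              (constraintAt_cons.1 (hcon (i + 4)))))
          exact ⟨.imp x y u v :: M, rfl⟩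
  · refine ⟨[], ?_⟩
    rw [List.eq_nil_of_length_eq_zero (Nat.le_zero.1 h0)]
    rfl

theorem exists_formula (h : (ofList T).Grammatical) : ∃ φ : Formula, φ.toks = T := by
  induction T with
  | nil => exact ⟨⟨[], []⟩, rfl⟩
  | cons p T ih =>
    have hcon : ∀ i, (ofList (p :: T)).ConstraintAt i := fun i h' => (h.2 i (lt_of_S h')).2 h'
    rcases h.1 with hq | hend
    · have h1 := (h.2 0 (Nat.succ_pos _)).1 hq
      rw [isQuant_cons, endAt_cons] at h1
      obtain ⟨φ, rfl⟩ := ih ⟨h1, fun i hi => by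
        have := h.2 (i + 1) (Nat.succ_lt_succ hi)
        rwa [isQuant_cons, isQuant_cons, endAt_cons, constraintAt_cons] at this⟩
      obtain ⟨s, x⟩ := p
      rcases hq with hq | hq <;> rw [ofList_S_zero] at hq <;> subst hq
      · exact ⟨⟨(.ex, x) :: φ.quants, φ.matrix⟩, rfl⟩
      · exact ⟨⟨(.all, x) :: φ.quants, φ.matrix⟩, rfl⟩
    · obtain ⟨M, hM⟩ := exists_matrix _ _ le_rfl hend hcon
      exact ⟨⟨[], M⟩, hM⟩

/-! The number of universal blocks -/

/-- The number of blocks of universal quantifiers that start in the list, if it is preceded by the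
quantifier `p`. -/
def starts : Quant → List Quant → ℕ
  | _, [] => 0
  | _, .ex :: l => starts .ex l
  | .ex, .all :: l => 1 + starts .all l
  | .all, .all :: l => starts .all l

theorem isBlocks_nil (q : Quant) (n : ℕ) : IsBlocks q n [] := by
  induction n generalizing q with
  | zero => rfl
  | succ n ih => exact ⟨0, [], rfl, ih _⟩

/-- As blocks may be empty, `q :: l` may also be split with two empty blocks in front. The rest then
has two blocks fewer and starts with kind `q` again, so induction applies. -/
theorem isBlocks_cons_self (q : Quant) (n : ℕ) (l : List Quant) :
    IsBlocks q (n + 1) (q :: l) ↔ IsBlocks q (n + 1) l := by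
  induction n using Nat.strong_induction_on with
  | _ n ih =>
  constructor
  · rintro ⟨m, l', h, h'⟩
    rcases m with _ | m
    · rw [List.replicate_zero, List.nil_append] at h
      subst h
      rcases n with _ | n
      · exact (List.cons_ne_nil _ _ h').elim
      · obtain ⟨m, l'', h, h'⟩ := h'
        rcases m with _ | m
        · rw [List.replicate_zero, List.nil_append] at h
          subst h
          have hd : ∀ q : Quant, q.dual.dual = q := by intro q; cases q <;> rfl
          rw [hd] at h'
          have hmono : ∀ (n : ℕ) (q : Quant) (l : List Quant), IsBlocks q n l →
              IsBlocks q (n + 1) l := by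
            intro n
            induction n with
            | zero => rintro q l rfl; exact isBlocks_nil _ _
            | succ n ih => exact fun q l ⟨m, l', h, h'⟩ => ⟨m, l', h, ih _ _ h'⟩
          rcases n with _ | n
          · exact (List.cons_ne_nil _ _ h').elim
          · exact hmono _ _ _ (hmono _ _ _ ((ih n (by omega)).1 h'))
        · rw [List.replicate_succ, List.cons_append] at h
          have := (List.cons.inj h).1
          cases q <;> exact Quant.noConfusion this
    · rw [List.replicate_succ, List.cons_append] at h
      exact ⟨m, l', (List.cons.inj h).2, h'⟩
  · rintro ⟨m, l', rfl, h'⟩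
    exact ⟨m + 1, l', rfl, h'⟩

theorem isBlocks_cons_dual (q : Quant) (n : ℕ) (l : List Quant) :
    IsBlocks q (n + 1) (q.dual :: l) ↔ IsBlocks q.dual n (q.dual :: l) := by
  constructor
  · rintro ⟨m, l', h, h'⟩
    rcases m with _ | m
    · rw [List.replicate_zero, List.nil_append] at h
      rwa [h]
    · rw [List.replicate_succ, List.cons_append] at h
      have := (List.cons.inj h).1
      cases q <;> exact Quant.noConfusion this
  · exact fun h => ⟨0, _, rfl, h⟩

/-- Both parts are proved together since reading a quantifier switches between them. In the second
the leading universal block is free, as `starts .all` treats it as the continuation of a block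
already begun. -/
theorem isBlocks_iff_starts (l : List Quant) (k : ℕ) :
    (IsBlocks .ex (2 * k + 1) l ↔ starts .ex l ≤ k) ∧
    (IsBlocks .all (2 * k + 2) l ↔ starts .all l ≤ k) := by
  induction l generalizing k with
  | nil => exact ⟨iff_of_true (isBlocks_nil _ _) (Nat.zero_le _),
      iff_of_true (isBlocks_nil _ _) (Nat.zero_le _)⟩
  | cons a l ih =>
    cases a with
    | ex =>
      have h1 : IsBlocks .ex (2 * k + 1) (.ex :: l) ↔ starts .ex l ≤ k :=
        (isBlocks_cons_self .ex (2 * k) l).trans (ih k).1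
      exact ⟨h1, (isBlocks_cons_dual .all (2 * k + 1) l).trans h1⟩
    | all =>
      refine ⟨(isBlocks_cons_dual .ex (2 * k) l).trans ?_,
        (isBlocks_cons_self .all (2 * k + 1) l).trans (ih k).2⟩
      rcases k with _ | k
      · exact iff_of_false (fun h => List.cons_ne_nil _ _ h) (by simp [starts])
      · refine ((isBlocks_cons_self .all (2 * k + 1) l).trans (ih k).2).trans ?_
        simp only [starts]
        omega

open Classical in
-- Entry `i` of `p :: l` is the predecessor of entry `i` of `l`. With `p = .ex`, position `0` counts
-- as a block start if it is universal, as in `lev`.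
theorem sum_starts (l : List Quant) : ∀ (p : Quant) (N : ℕ), l.length ≤ N →
    (∑ i ∈ Finset.range N, if l[i]? = some .all ∧ ¬ (p :: l)[i]? = some .all then 1 else 0) =
      starts p l := by
  induction l with
  | nil => intro p N _; simp [starts]
  | cons a l ih =>
    intro p N hN
    obtain ⟨N, rfl⟩ : ∃ N', N = N' + 1 := ⟨N - 1, by simp at hN; omega⟩
    rw [Finset.sum_range_succ']
    simp only [List.getElem?_cons_succ, List.getElem?_cons_zero]
    rw [ih a N (by simpa using hN)]
    cases a <;> cases p <;> simp [starts, Nat.add_comm]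

end Tokens

end EqQCSP

namespace EqQCSP

/-! ### Sentences are represented by their tokens -/

namespace Tokens

/-- The name of the variable of a token. -/
def nameAt (T : List (Sym × Var)) (i : ℕ) : Var := (T[i]?.map Prod.snd).getD []

theorem nameAt_eq {T : List (Sym × Var)} {i : ℕ} {s : Sym} {v : Var} (h : T[i]? = some (s, v)) :
    nameAt T i = v := by
  simp [nameAt, h]

theorem same_iff_nameAt {T : List (Sym × Var)} {i j : ℕ} (hi : i < T.length) (hj : j < T.length) :
    (ofList T).same i j ↔ nameAt T i = nameAt T j := by
  have h1 := List.getElem?_eq_getElem hi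
  have h2 := List.getElem?_eq_getElem hj
  generalize T[i] = p at h1
  generalize T[j] = q at h2
  obtain ⟨s, v⟩ := p
  obtain ⟨s', v'⟩ := q
  rw [nameAt_eq h1, nameAt_eq h2]
  simp only [ofList, h1, h2, Option.some.injEq, Prod.mk.injEq]
  constructor
  · refine fun h => List.ext_getElem? fun u => Option.ext fun b => ?_
    have := h u b
    constructor
    · intro hv
      obtain ⟨_, _, ⟨-, rfl⟩, h⟩ := this.1 ⟨s, v, ⟨rfl, rfl⟩, hv⟩
      exact h
    · intro hv
      obtain ⟨_, _, ⟨-, rfl⟩, h⟩ := this.2 ⟨s', v', ⟨rfl, rfl⟩, hv⟩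
      exact h
  · rintro rfl u b
    exact ⟨fun ⟨_, w, ⟨_, h⟩, h'⟩ => ⟨s', w, ⟨rfl, h⟩, h'⟩,
      fun ⟨_, w, ⟨_, h⟩, h'⟩ => ⟨s, w, ⟨rfl, h⟩, h'⟩⟩

theorem S_unique {T : List (Sym × Var)} {i : ℕ} {s s' : Sym} (h : (ofList T).S i s)
    (h' : (ofList T).S i s') : s = s' := by
  obtain ⟨v, h⟩ := h
  obtain ⟨v', h'⟩ := h'
  rw [h] at h'
  exact congrArg Prod.fst (Option.some.inj h')

theorem not_S_of_endAt {T : List (Sym × Var)} {i : ℕ} {s : Sym} (hs : s ≠ .and)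
    (h : (ofList T).EndAt i) : ¬ (ofList T).S i s := by
  intro h'
  rcases h with h | h
  · exact hs (S_unique h' h)
  · exact absurd (lt_of_S h') (not_lt.2 h)

/-- The constraint that starts at the token `a`, if any, is satisfied. -/
def SatAt (T : List (Sym × Var)) (ρ : Var → ℕ) (a : ℕ) : Prop :=
  (ofList T).S a .and →
    (¬ (ofList T).S (a + 2) .imp → ρ (nameAt T a) = ρ (nameAt T (a + 1))) ∧
    ((ofList T).S (a + 2) .imp → ρ (nameAt T a) = ρ (nameAt T (a + 1)) →
      ρ (nameAt T (a + 2)) = ρ (nameAt T (a + 3)))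

theorem forall_satAt_cons {p : Sym × Var} {T : List (Sym × Var)} {ρ : Var → ℕ} :
    (∀ a, SatAt (p :: T) ρ a) ↔ SatAt (p :: T) ρ 0 ∧ ∀ a, SatAt T ρ a := by
  have h : ∀ a, SatAt (p :: T) ρ (a + 1) ↔ SatAt T ρ a := fun a => Iff.rfl
  constructor
  · exact fun hp => ⟨hp 0, fun a => (h a).1 (hp (a + 1))⟩
  · rintro ⟨h0, h1⟩ (_ | a)
    exacts [h0, (h a).2 (h1 a)]

theorem forall_satAt_cons_of_ne {a : Sym} {x : Var} {T : List (Sym × Var)} {ρ : Var → ℕ}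
    (h : a ≠ .and) : (∀ i, SatAt ((a, x) :: T) ρ i) ↔ ∀ i, SatAt T ρ i :=
  forall_satAt_cons.trans (and_iff_right fun h' => (h ((ofList_S_zero _ _ _ _).1 h')).elim)

theorem forall_satAt_flatMap (M : List Constraint) (ρ : Var → ℕ) :
    (∀ a, SatAt (M.flatMap Constraint.toks) ρ a) ↔ ∀ C ∈ M, C.Sat ρ := by
  induction M with
  | nil => exact iff_of_true (fun a ⟨v, h⟩ => by simp at h) (by simp)
  | cons C M ih =>
    rw [List.forall_mem_cons, ← ih, List.flatMap_cons]
    have hend := endAt_flatMap M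
    cases C with
    | eq x y =>
      simp only [Constraint.toks, List.cons_append, List.nil_append]
      rw [forall_satAt_cons, forall_satAt_cons_of_ne (by simp), and_congr_left_iff]
      intro _
      have himp : ¬ (ofList ((Sym.and, x) :: (Sym.eq, y) :: M.flatMap Constraint.toks)).S (0 + 2)
          .imp := by
        rw [ofList_S_cons, ofList_S_cons]
        exact not_S_of_endAt (by simp) hend
      exact ⟨fun h => (h ⟨_, rfl⟩).1 himp, fun h _ => ⟨fun _ => h, fun h' => (himp h').elim⟩⟩
    | imp x y u v =>
      simp only [Constraint.toks, List.cons_append, List.nil_append]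
      rw [forall_satAt_cons, forall_satAt_cons_of_ne (by simp),
        forall_satAt_cons_of_ne (by simp), forall_satAt_cons_of_ne (by simp), and_congr_left_iff]
      intro _
      exact ⟨fun h => (h ⟨_, rfl⟩).2 ⟨_, rfl⟩, fun h _ => ⟨fun h' => (h' ⟨_, rfl⟩).elim,
        fun _ => h⟩⟩

theorem forall_satAt_toks (φ : Formula) (ρ : Var → ℕ) :
    (∀ a, SatAt φ.toks ρ a) ↔ ∀ C ∈ φ.matrix, C.Sat ρ := by
  rw [← forall_satAt_flatMap]
  obtain ⟨Q, M⟩ := φ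
  unfold Formula.toks
  simp only
  induction Q with
  | nil => rfl
  | cons q Q ih =>
    rw [List.map_cons, List.cons_append, forall_satAt_cons_of_ne, ih]
    cases q.1 <;> simp [Quant.sym]

theorem toks_getElem? (φ : Formula) {i : ℕ} (hi : i < φ.quants.length) :
    φ.toks[i]? = some (φ.quants[i].1.sym, φ.quants[i].2) := by
  rw [Formula.toks, List.getElem?_append_left (by simpa using hi)]
  simp [hi]

theorem lt_of_isQuant {φ : Formula} {i : ℕ} (h : (ofList φ.toks).IsQuant i) :
    i < φ.quants.length := by
  by_contra hi
  refine not_isQuant_flatMap φ.matrix (i - φ.quants.length) ?_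
  simp only [IsQuant, ofList] at h ⊢
  rwa [Formula.toks, List.getElem?_append_right (by simpa using hi), List.length_map] at h

theorem sym_eq_iff {φ : Formula} {i : ℕ} (hi : i < φ.quants.length) (s : Sym) :
    (ofList φ.toks).S i s ↔ φ.quants[i].1.sym = s := by
  simp [ofList, toks_getElem? φ hi]

theorem S_quant_iff (φ : Formula) (q : Quant) (i : ℕ) :
    (ofList φ.toks).S i q.sym ↔ ∃ h : i < φ.quants.length, φ.quants[i].1 = q := by
  constructor
  · intro h
    have hi : i < φ.quants.length := lt_of_isQuant (by cases q; exacts [.inl h, .inr h])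
    refine ⟨hi, ?_⟩
    rw [sym_eq_iff hi] at h
    revert h
    cases φ.quants[i].1 <;> cases q <;> simp [Quant.sym]
  · rintro ⟨hi, h⟩
    rw [sym_eq_iff hi, h]

theorem isQuant_iff_lt {φ : Formula} {i : ℕ} :
    (ofList φ.toks).IsQuant i ↔ i < φ.quants.length := by
  refine ⟨lt_of_isQuant, fun h => ?_⟩
  rcases hq : φ.quants[i].1
  · exact .inl ((S_quant_iff φ .ex i).2 ⟨h, hq⟩)
  · exact .inr ((S_quant_iff φ .all i).2 ⟨h, hq⟩)

theorem length_le_toks (φ : Formula) : φ.quants.length ≤ φ.toks.length := by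
  simp [Formula.toks]

theorem nameAt_toks {φ : Formula} {i : ℕ} (hi : i < φ.quants.length) :
    nameAt φ.toks i = φ.quants[i].2 := nameAt_eq (toks_getElem? φ hi)

theorem vars_iff_closed (φ : Formula) :
    (∀ C ∈ φ.matrix, ∀ x ∈ C.vars, x ∈ φ.quants.map Prod.snd) ↔
      ∀ i < φ.toks.length, ∃ j < φ.quants.length, nameAt φ.toks j = nameAt φ.toks i := by
  have hvars : ∀ (C : Constraint) (x : Var), x ∈ C.vars ↔ ∃ s, (s, x) ∈ C.toks := by
    intro C x
    cases C <;> simp [Constraint.vars, Constraint.toks, exists_or]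
  have hmem : ∀ x, x ∈ φ.quants.map Prod.snd ↔ ∃ j < φ.quants.length, nameAt φ.toks j = x := by
    intro x
    rw [List.mem_map]
    constructor
    · rintro ⟨p, hp, rfl⟩
      obtain ⟨j, hj, rfl⟩ := List.mem_iff_getElem.1 hp
      exact ⟨j, hj, nameAt_toks hj⟩
    · rintro ⟨j, hj, rfl⟩
      exact ⟨_, List.getElem_mem hj, (nameAt_toks hj).symm⟩
  constructor
  · intro h i hi
    rw [← hmem]
    by_cases hq : i < φ.quants.length
    · exact (hmem _).2 ⟨i, hq, rfl⟩
    · have h1 : (φ.matrix.flatMap Constraint.toks)[i - φ.quants.length]? = φ.toks[i]? := by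
        rw [Formula.toks, List.getElem?_append_right (by simpa using hq), List.length_map]
      rw [List.getElem?_eq_getElem hi] at h1
      obtain ⟨C, hC, hp⟩ := List.mem_flatMap.1 (List.mem_of_getElem? h1)
      rw [nameAt_eq (s := φ.toks[i].1) (v := φ.toks[i].2) (List.getElem?_eq_getElem hi)]
      exact h C hC _ ((hvars C _).2 ⟨_, hp⟩)
  · intro h C hC x hx
    obtain ⟨s, hs⟩ := (hvars C x).1 hx
    have : (s, x) ∈ φ.toks := List.mem_append_right _ (List.mem_flatMap.2 ⟨C, hC, hs⟩)
    obtain ⟨i, hi, h1⟩ := List.mem_iff_getElem.1 this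
    have h2 := h i hi
    rwa [← hmem, nameAt_eq (s := s) (v := x) (by rw [List.getElem?_eq_getElem hi, h1])] at h2

theorem nodup_iff_inj (φ : Formula) : (φ.quants.map Prod.snd).Nodup ↔
    ∀ i < φ.quants.length, ∀ j < φ.quants.length, nameAt φ.toks i = nameAt φ.toks j → i = j := by
  rw [List.nodup_iff_injective_getElem]
  constructor
  · intro h i hi j hj hij
    have := @h ⟨i, by simpa using hi⟩ ⟨j, by simpa using hj⟩ (by
      simpa [nameAt_toks hi, nameAt_toks hj] using hij)
    simpa using this
  · rintro h ⟨i, hi⟩ ⟨j, hj⟩ hij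
    have hi' : i < φ.quants.length := by simpa using hi
    have hj' : j < φ.quants.length := by simpa using hj
    simpa using h i hi' j hj' (by simpa [nameAt_toks hi', nameAt_toks hj'] using hij)

theorem represents_toks {φ : Formula} (h : φ.IsSentence) :
    (ofList φ.toks).Represents (nameAt φ.toks) φ.quants φ.matrix where
  le := length_le_toks φ
  nm_eq _ hi := nameAt_toks hi
  inj := (nodup_iff_inj φ).1 h.1
  all_iff := S_quant_iff φ .all
  ex_iff := S_quant_iff φ .ex
  same_iff _ hi _ hj := same_iff_nameAt hi hj
  closed := (vars_iff_closed φ).1 h.2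
  and_lt a ha := lt_of_S (((grammatical_toks φ).2 a (lt_of_S ha)).2 ha).1
  imp_lt a ha h2 := by
    rcases (((grammatical_toks φ).2 a (lt_of_S ha)).2 ha).2 with h' | h'
    · exact (not_S_of_endAt (by simp) h' h2).elim
    · exact lt_of_S h'.2.1
  sat_iff ρ := by
    rw [← forall_satAt_toks]
    exact ⟨fun h => ⟨fun a ha => (h a ha).1, fun a ha => (h a ha).2⟩,
      fun h a ha => ⟨h.1 a ha, h.2 a ha⟩⟩

theorem lev_length (φ : Formula) :
    (ofList φ.toks).lev φ.toks.length = starts .ex (φ.quants.map Prod.fst) := by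
  classical
  rw [← sum_starts (φ.quants.map Prod.fst) .ex (φ.toks.length + 1) (by
    rw [List.length_map]; exact (length_le_toks φ).trans (Nat.le_succ _)), lev]
  have hall : ∀ i, (φ.quants.map Prod.fst)[i]? = some .all ↔ (ofList φ.toks).S i .all := by
    intro i
    rw [show Sym.all = Quant.all.sym from rfl, S_quant_iff, List.getElem?_eq_some_iff]
    simp
  refine Finset.sum_congr rfl fun i _ => if_congr ?_ rfl rfl
  rw [hall]
  refine and_congr_right fun _ => not_congr ?_
  rcases i with _ | i
  · simp
  · rw [List.getElem?_cons_succ, hall]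
    simp

theorem wellFormed_toks (φ : Formula) (k : ℕ) :
    (ofList φ.toks).WellFormed k ↔ φ.IsSentence ∧ φ.IsSigma (2 * k + 1) := by
  rw [WellFormed, and_iff_right (grammatical_toks φ), Formula.IsSentence, Formula.IsSigma,
    (isBlocks_iff_starts _ _).1, nodup_iff_inj, vars_iff_closed, ← lev_length, and_assoc]
  have hle := length_le_toks φ
  refine and_congr ⟨fun h i hi j hj hij => ?_, fun h i hi j hj hqi hqj hij => ?_⟩
    (and_congr ⟨fun h i hi => ?_, fun h i hi => ?_⟩ Iff.rfl)
  · exact h i (hi.trans_le hle) j (hj.trans_le hle) (isQuant_iff_lt.2 hi) (isQuant_iff_lt.2 hj)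
      ((same_iff_nameAt (hi.trans_le hle) (hj.trans_le hle)).2 hij)
  · exact h i (isQuant_iff_lt.1 hqi) j (isQuant_iff_lt.1 hqj) ((same_iff_nameAt hi hj).1 hij)
  · obtain ⟨j, hj, hq, hs⟩ := h i hi
    exact ⟨j, isQuant_iff_lt.1 hq, ((same_iff_nameAt hi hj).1 hs).symm⟩
  · obtain ⟨j, hj, hs⟩ := h i hi
    exact ⟨j, hj.trans_le hle, isQuant_iff_lt.2 hj,
      (same_iff_nameAt hi (hj.trans_le hle)).2 hs.symm⟩

theorem WellFormed.exists_formula {T : List (Sym × Var)} {k : ℕ} (h : (ofList T).WellFormed k) :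
    ∃ φ : Formula, φ.IsSentence ∧ φ.IsSigma (2 * k + 1) ∧ φ.toks = T := by
  obtain ⟨φ, rfl⟩ := Tokens.exists_formula h.1
  exact ⟨φ, ((wellFormed_toks φ k).1 h).1, ((wellFormed_toks φ k).1 h).2, rfl⟩

end Tokens

end EqQCSP

namespace EqQCSP

/-! ### The tokens of a word -/

/-- The variable that is spelled at the beginning of a word. -/
def bits : List Sym → Var
  | .bit b :: x => b :: bits x
  | _ => []

/-- The tokens of a word. -/
def toks : List Sym → List (Sym × Var)
  | [] => []
  | .bit _ :: x => toks x
  | .ex :: x => (.ex, bits x) :: toks x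
  | .all :: x => (.all, bits x) :: toks x
  | .and :: x => (.and, bits x) :: toks x
  | .eq :: x => (.eq, bits x) :: toks x
  | .imp :: x => (.imp, bits x) :: toks x

/-- The word spelled by tokens. -/
def untok (T : List (Sym × Var)) : List Sym := T.flatMap fun p => p.1 :: Var.encode p.2

theorem encode_eq_untok (φ : Formula) : φ.encode = untok φ.toks := by
  rw [Formula.encode, Formula.toks, untok, List.flatMap_append, List.flatMap_assoc,
    List.flatMap_map]
  congr 1
  refine congrArg (List.flatMap · _) (funext fun C => ?_)
  cases C <;> simp [Constraint.encode, Constraint.toks]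

/-- Splitting a word into tokens loses only its leading bits, so a word without leading bits is
determined by its tokens. -/
theorem bits_append_untok (x : List Sym) : Var.encode (bits x) ++ untok (toks x) = x := by
  induction x with
  | nil => rfl
  | cons s x ih =>
    cases s with
    | bit b => exact congrArg (List.cons _) ih
    | _ => exact congrArg (List.cons _) ih

theorem toks_encode_append (v : Var) (x : List Sym) : toks (v.encode ++ x) = toks x := by
  induction v with
  | nil => rfl
  | cons b v ih => exact ih

theorem bits_encode_append (v : Var) {x : List Sym} (hx : bits x = []) :
    bits (v.encode ++ x) = v := by
  induction v with
  | nil => exact hx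
  | cons b v ih => exact congrArg (List.cons b) ih

theorem toks_untok {T : List (Sym × Var)} (hT : ∀ p ∈ T, ∀ b, p.1 ≠ .bit b) :
    toks (untok T) = T ∧ bits (untok T) = [] := by
  induction T with
  | nil => exact ⟨rfl, rfl⟩
  | cons p T ih =>
    obtain ⟨s, v⟩ := p
    rw [List.forall_mem_cons] at hT
    obtain ⟨h1, h2⟩ := ih hT.2
    have e : untok ((s, v) :: T) = s :: (v.encode ++ untok T) := rfl
    rw [e]
    have h3 := toks_encode_append v (untok T)
    have h4 := bits_encode_append v h2
    rw [h1] at h3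
    cases s with
    | bit b => exact (hT.1 b rfl).elim
    | _ => exact ⟨by rw [toks, h3, h4], rfl⟩

theorem toks_encode (φ : Formula) : toks φ.encode = φ.toks ∧ bits φ.encode = [] := by
  rw [encode_eq_untok]
  refine toks_untok fun p hp b => ?_
  rcases List.mem_append.1 hp with hp | hp
  · obtain ⟨q, -, rfl⟩ := List.mem_map.1 hp
    cases q.1 <;> simp [Quant.sym]
  · obtain ⟨C, -, hC⟩ := List.mem_flatMap.1 hp
    cases C <;> simp only [Constraint.toks, List.mem_cons, List.not_mem_nil, or_false] at hC
    · rcases hC with rfl | rfl <;> simp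
    · rcases hC with rfl | rfl | rfl | rfl <;> simp

theorem exists_sentence_iff {x : List Sym} {k : ℕ} :
    (∃ φ : Formula, φ.IsSentence ∧ φ.IsSigma (2 * k + 1) ∧ φ.encode = x) ↔
      bits x = [] ∧ (Tokens.ofList (toks x)).WellFormed k := by
  constructor
  · rintro ⟨φ, h1, h2, rfl⟩
    rw [(toks_encode φ).1, Tokens.wellFormed_toks]
    exact ⟨(toks_encode φ).2, h1, h2⟩
  · rintro ⟨h1, h2⟩
    obtain ⟨φ, h3, h4, h5⟩ := h2.exists_formula
    refine ⟨φ, h3, h4, ?_⟩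
    rw [encode_eq_untok, h5]
    conv_rhs => rw [← bits_append_untok x, h1]
    rfl

/-- Describes the letters of a variable by bounded quantifiers over positions, as the verifier
needs. -/
theorem bits_getElem? (x : List Sym) (u : ℕ) (b : Bool) : (bits x)[u]? = some b ↔
    (∀ i < u, x[i]? = some (.bit false) ∨ x[i]? = some (.bit true)) ∧ x[u]? = some (.bit b) := by
  induction x generalizing u with
  | nil => simp [bits]
  | cons s x ih =>
    cases s with
    | bit c =>
      rw [bits]
      rcases u with _ | u
      · simp
      · rw [List.getElem?_cons_succ, List.getElem?_cons_succ, ih, Nat.forall_lt_succ_left']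
        have : c = false ∨ c = true := by cases c <;> simp
        simp [this]
    | _ =>
      rw [bits]
      rcases u with _ | u
      · simp
      · rw [Nat.forall_lt_succ_left']
        simp
      all_goals simp

/-! Tokens described by positions in the word -/

section Positions

variable (w : ℕ → Sym → Prop)

/-- A token starts at the position `p`. -/
def Head (p : ℕ) : Prop := w p .ex ∨ w p .all ∨ w p .and ∨ w p .eq ∨ w p .imp

open Classical in
/-- The number of tokens that start before the position `p`. -/
noncomputable def cnt (p : ℕ) : ℕ := ∑ j ∈ Finset.range p, if Head w j then 1 else 0

/-- The token `j` starts at the position `p`. -/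
def TokAt (j p : ℕ) : Prop := Head w p ∧ cnt w p = j

/-- The token `j` has the symbol `s`. -/
def SymAt (n j : ℕ) (s : Sym) : Prop := ∃ p < n, TokAt w j p ∧ w p s

/-- The letter `u` of the variable of the token `j` is `b`. -/
def Letter (n j u : ℕ) (b : Bool) : Prop :=
  ∃ p < n, TokAt w j p ∧
    (∀ i < u, w (p + 1 + i) (.bit false) ∨ w (p + 1 + i) (.bit true)) ∧ w (p + 1 + u) (.bit b)

/-- The tokens `i` and `j` have the same variable. -/
def SameVar (n i j : ℕ) : Prop :=
  ∀ u < n, (Letter w n i u false ↔ Letter w n j u false) ∧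
    (Letter w n i u true ↔ Letter w n j u true)

/-- The tokens of a word of length at most `n`. -/
noncomputable def ofWord (n : ℕ) : Tokens := ⟨cnt w n, SymAt w n, SameVar w n⟩

end Positions

/-- The word as a predicate on positions and symbols. -/
def Spells (x : List Sym) (p : ℕ) (s : Sym) : Prop := x[p]? = some s

theorem spells_succ (a : Sym) (x : List Sym) (p : ℕ) (s : Sym) :
    Spells (a :: x) (p + 1) s ↔ Spells x p s := by
  rw [Spells, List.getElem?_cons_succ, Spells]

theorem head_succ (a : Sym) (x : List Sym) (p : ℕ) :
    Head (Spells (a :: x)) (p + 1) ↔ Head (Spells x) p := by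
  simp only [Head, spells_succ]

theorem cnt_succ (a : Sym) (x : List Sym) (p : ℕ) : cnt (Spells (a :: x)) (p + 1) =
    cnt (Spells x) p + cnt (Spells (a :: x)) 1 := by
  classical
  rw [cnt, Finset.sum_range_succ', cnt, cnt, Finset.sum_range_one]
  simp only [head_succ]

theorem lt_of_head {x : List Sym} {p : ℕ} (h : Head (Spells x) p) : p < x.length := by
  rcases h with h | h | h | h | h <;> exact (List.getElem?_eq_some_iff.1 h).1

theorem head_zero (a : Sym) (x : List Sym) :
    Head (Spells (a :: x)) 0 ↔ ∀ b, a ≠ .bit b := by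
  cases a <;> simp [Head, Spells]

theorem toks_cons {a : Sym} (ha : ∀ b, a ≠ .bit b) (x : List Sym) :
    toks (a :: x) = (a, bits x) :: toks x := by
  cases a with
  | bit b => exact (ha b rfl).elim
  | _ => rfl

theorem toks_getElem?_iff (x : List Sym) (j : ℕ) (s : Sym) (v : Var) :
    (toks x)[j]? = some (s, v) ↔
      ∃ p, TokAt (Spells x) j p ∧ Spells x p s ∧ bits (x.drop (p + 1)) = v := by
  classical
  induction x generalizing j with
  | nil =>
    refine iff_of_false (by simp [toks]) ?_
    rintro ⟨p, ⟨h, -⟩, -⟩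
    exact absurd (lt_of_head h) (by simp)
  | cons a x ih =>
    have h0 : cnt (Spells (a :: x)) 0 = 0 := rfl
    have h1 : cnt (Spells (a :: x)) 1 = if Head (Spells (a :: x)) 0 then 1 else 0 :=
      Finset.sum_range_one _
    rw [← Nat.or_exists_add_one]
    simp only [TokAt, head_succ, cnt_succ, spells_succ, List.drop_succ_cons, List.drop_zero, h0, h1]
    by_cases hb : ∀ b, a ≠ .bit b
    · have hh := (head_zero a x).2 hb
      rw [toks_cons hb, if_pos hh]
      rcases j with _ | j
      · simp [hh, Spells]
      · rw [List.getElem?_cons_succ, ih]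
        simp [TokAt]
    · have hh := (head_zero a x).not.2 hb
      rw [if_neg hh]
      push Not at hb
      obtain ⟨b, rfl⟩ := hb
      rw [toks, ih]
      simp [TokAt, hh]

theorem cnt_length (x : List Sym) : cnt (Spells x) x.length = (toks x).length := by
  classical
  induction x with
  | nil => rfl
  | cons a x ih =>
    rw [List.length_cons, cnt_succ, ih, cnt, Finset.sum_range_one]
    by_cases hb : ∀ b, a ≠ .bit b
    · rw [toks_cons hb, if_pos ((head_zero a x).2 hb), List.length_cons]
    · rw [if_neg ((head_zero a x).not.2 hb)]
      push Not at hb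
      obtain ⟨b, rfl⟩ := hb
      rfl

/-- Ties the token structure defined by counting positions, which is definable by bounded sums, to
the recursively defined token list. All bounded searches may stop at `n` because tokens and letters
lie inside the word. -/
theorem ofWord_spells (x : List Sym) {n : ℕ} (hn : x.length ≤ n) :
    ofWord (Spells x) n = Tokens.ofList (toks x) := by
  classical
  have hS : ∀ j s, SymAt (Spells x) n j s ↔ ∃ v, (toks x)[j]? = some (s, v) := by
    intro j s
    simp only [toks_getElem?_iff]
    exact ⟨fun ⟨p, _, h, h'⟩ => ⟨_, p, h, h', rfl⟩,
      fun ⟨_, p, h, h', _⟩ => ⟨p, (lt_of_head h.1).trans_le hn, h, h'⟩⟩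
  have hL : ∀ j u b, Letter (Spells x) n j u b ↔
      ∃ (s : Sym) (v : Var), (toks x)[j]? = some (s, v) ∧ v[u]? = some b := by
    intro j u b
    simp only [toks_getElem?_iff]
    have hb : ∀ p, (bits (x.drop (p + 1)))[u]? = some b ↔
        (∀ i < u, Spells x (p + 1 + i) (.bit false) ∨ Spells x (p + 1 + i) (.bit true)) ∧
          Spells x (p + 1 + u) (.bit b) := by
      intro p
      simp only [bits_getElem?, List.getElem?_drop, Spells]
    constructor
    · rintro ⟨p, _, h, h'⟩
      obtain ⟨s, hs⟩ : ∃ s, Spells x p s :=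
        ⟨_, List.getElem?_eq_getElem (lt_of_head h.1)⟩
      exact ⟨s, _, ⟨p, h, hs, rfl⟩, (hb p).2 h'⟩
    · rintro ⟨s, _, ⟨p, h, hs, rfl⟩, h'⟩
      exact ⟨p, (lt_of_head h.1).trans_le hn, h, (hb p).1 h'⟩
  have hlt : ∀ j u b, Letter (Spells x) n j u b → u < n := by
    rintro j u b ⟨p, -, -, -, h⟩
    have := (List.getElem?_eq_some_iff.1 h).1
    omega
  rw [ofWord, Tokens.ofList]
  congr 1
  · rw [← cnt_length, cnt, cnt, ← Finset.sum_subset (Finset.range_mono hn)]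
    intro p _ hp
    exact if_neg fun h => hp (Finset.mem_range.2 (lt_of_head h))
  · funext j s
    exact propext (hS j s)
  · funext i j
    simp only [← hL, SameVar]
    refine propext ⟨fun h u b => ?_, fun h u _ => ⟨h u false, h u true⟩⟩
    by_cases hu : u < n
    · cases b
      exacts [(h u hu).1, (h u hu).2]
    · exact iff_of_false (fun h => hu (hlt _ _ _ h)) (fun h => hu (hlt _ _ _ h))

end EqQCSP

namespace EqQCSP

/-! ### Checking a refutation -/

/-- The symbols of the input in a word that is followed by a certificate. -/
def syms (w : List (Sym ⊕ Bool)) (p : ℕ) (s : Sym) : Prop := w[p]? = some (.inl s)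

open Classical in
/-- The length of the input in a word that is followed by a certificate. -/
noncomputable def inputLength (w : List (Sym ⊕ Bool)) : ℕ :=
  ∑ p ∈ Finset.range w.length,
    if Head (syms w) p ∨ syms w p (.bit false) ∨ syms w p (.bit true) then 1 else 0

/-- The number of contexts in a refutation for a word of length `n`. -/
def numCtx (k n : ℕ) : ℕ := (1 + n * n) ^ (k + 1)

/-- The largest number in the certificate for a word of length `n`. -/
def maxEntry (k n : ℕ) : ℕ := numCtx k n * (n * n) + n

open Classical in
/-- The `j`-th number in the certificate, written in unary with `T` digits. -/
noncomputable def entry (T : ℕ) (w : List (Sym ⊕ Bool)) (j : ℕ) : ℕ :=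
  ∑ r ∈ Finset.range T,
    if w[inputLength w + (j * T + r)]? = some (.inr true) then 1 else 0

/-- The tokens of the input. -/
noncomputable def inputTokens (w : List (Sym ⊕ Bool)) : Tokens := ofWord (syms w) (inputLength w)

/-- The input is not a sentence of the right form, or the certificate describes a refutation. -/
def Check (k : ℕ) (w : List (Sym ⊕ Bool)) : Prop :=
  ¬ (¬ (syms w 0 (.bit false) ∨ syms w 0 (.bit true)) ∧ (inputTokens w).WellFormed k) ∨
  (inputTokens w).Refut (numCtx k (inputLength w))
    -- Each context and token owns a row of `n + 1` numbers, where `n` is the input length: the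
    -- ranks in columns `0, …, n - 1`, the value of the pattern in column `n`.
    (fun s i => entry (maxEntry k (inputLength w)) w
      ((s * inputLength w + i) * (inputLength w + 1) + inputLength w))
    fun s a b => entry (maxEntry k (inputLength w)) w
      ((s * inputLength w + a) * (inputLength w + 1) + b)

section Definability

variable {f g : List (Sym ⊕ Bool) → (ℕ → ℕ) → ℕ}

instance BP.syms (s : Sym) [BS f] : BP fun w v => syms w (f w v) s :=
  BP.symbol (Sum.inl s)

instance BP.head [BS f] : BP fun w v => Head (EqQCSP.syms w) (f w v) := by
  unfold Head
  infer_instance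

instance BS.inputLength : BS fun w _ => inputLength w := by
  unfold EqQCSP.inputLength
  infer_instance

instance BS.cnt [hf : BS f] : BS fun w v => cnt (EqQCSP.syms w) (f w v) := by
  unfold EqQCSP.cnt
  infer_instance

instance BP.tokAt [BS f] [BS g] : BP fun w v => TokAt (EqQCSP.syms w) (f w v) (g w v) := by
  unfold TokAt
  infer_instance

instance BP.symAt [hf : BS f] (s : Sym) :
    BP fun w v => SymAt (EqQCSP.syms w) (EqQCSP.inputLength w) (f w v) s := by
  refine BP.subst₂ (P := fun w a _ => SymAt (EqQCSP.syms w) (EqQCSP.inputLength w) a s) ?_ f f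
  unfold SymAt
  infer_instance

instance BP.letter [hf : BS f] [hg : BS g] (b : Bool) :
    BP fun w v => Letter (EqQCSP.syms w) (EqQCSP.inputLength w) (f w v) (g w v) b := by
  refine BP.subst₂ (P := fun w i j => Letter (EqQCSP.syms w) (EqQCSP.inputLength w) i j b) ?_ f g
  unfold Letter
  infer_instance

instance BP.sameVar [hf : BS f] [hg : BS g] :
    BP fun w v => SameVar (EqQCSP.syms w) (EqQCSP.inputLength w) (f w v) (g w v) := by
  refine BP.subst₂ (P := fun w i j => SameVar (EqQCSP.syms w) (EqQCSP.inputLength w) i j) ?_ f g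
  unfold SameVar
  infer_instance

instance BS.lev [hf : BS f] : BS fun w v => (inputTokens w).lev (f w v) := by
  refine BS.subst₂ (F := fun w i _ => (inputTokens w).lev i) ?_ f f
  dsimp only [Tokens.lev, inputTokens, ofWord]
  infer_instance

instance BS.numCtx (k : ℕ) [BS f] : BS fun w v => numCtx k (f w v) := by
  unfold EqQCSP.numCtx
  infer_instance

instance BS.entry (k : ℕ) [hf : BS f] :
    BS fun w v => entry (maxEntry k (EqQCSP.inputLength w)) w (f w v) := by
  refine BS.subst₂ (F := fun w i _ => EqQCSP.entry (maxEntry k (EqQCSP.inputLength w)) w i) ?_ f f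
  unfold EqQCSP.entry maxEntry
  infer_instance

instance BP.endAt [BS f] : BP fun w v => (inputTokens w).EndAt (f w v) := by
  dsimp only [Tokens.EndAt, inputTokens, ofWord]
  infer_instance

instance BP.isQuant [BS f] : BP fun w v => (inputTokens w).IsQuant (f w v) := by
  dsimp only [Tokens.IsQuant, inputTokens, ofWord]
  infer_instance

instance BP.wellFormed (k : ℕ) : BP fun w _ => (inputTokens w).WellFormed k := by
  unfold Tokens.WellFormed Tokens.Grammatical Tokens.ConstraintAt
  have hm : ∀ w, (inputTokens w).m = EqQCSP.cnt (EqQCSP.syms w) (EqQCSP.inputLength w) :=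
    fun _ => rfl
  have hS : ∀ w i s, (inputTokens w).S i s =
    SymAt (EqQCSP.syms w) (EqQCSP.inputLength w) i s := fun _ _ _ => rfl
  have hs : ∀ w i j, (inputTokens w).same i j =
    SameVar (EqQCSP.syms w) (EqQCSP.inputLength w) i j := fun _ _ _ => rfl
  simp only [hm, hS, hs]
  infer_instance

set_option synthInstance.maxSize 1000 in
theorem bp_check (k : ℕ) : BP fun w _ => Check k w := by
  unfold Check Tokens.Refut Tokens.Just Tokens.Agree
  have hm : ∀ w, (inputTokens w).m = EqQCSP.cnt (EqQCSP.syms w) (EqQCSP.inputLength w) :=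
    fun _ => rfl
  have hS : ∀ w i s, (inputTokens w).S i s =
    SymAt (EqQCSP.syms w) (EqQCSP.inputLength w) i s := fun _ _ _ => rfl
  have hs : ∀ w i j, (inputTokens w).same i j =
    SameVar (EqQCSP.syms w) (EqQCSP.inputLength w) i j := fun _ _ _ => rfl
  simp only [hm, hS, hs]
  infer_instance

end Definability

/-! ### Certificates -/

theorem syms_pairWord (x : List Sym) (c : List Bool) : syms (pairWord (x, c)) = Spells x := by
  funext p s
  simp only [syms, pairWord, Spells, eq_iff_iff]
  by_cases hp : p < x.length
  · rw [List.getElem?_append_left (by simpa using hp)]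
    simp
  · rw [List.getElem?_append_right (by simpa using hp),
      List.getElem?_eq_none (l := x) (not_lt.1 hp)]
    simp

theorem inputLength_pairWord (x : List Sym) (c : List Bool) :
    inputLength (pairWord (x, c)) = x.length := by
  classical
  have h : ∀ p, (Head (Spells x) p ∨ Spells x p (.bit false) ∨ Spells x p (.bit true)) ↔
      p < x.length := by
    intro p
    constructor
    · rintro (h | h | h)
      exacts [lt_of_head h, (List.getElem?_eq_some_iff.1 h).1, (List.getElem?_eq_some_iff.1 h).1]
    · intro hp
      have h := List.getElem?_eq_getElem hp
      simp only [Head, Spells, h]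
      rcases x[p] with _ | _ | _ | _ | _ | _ | _ <;> simp
  rw [inputLength, syms_pairWord]
  simp only [h]
  rw [← Finset.sum_subset (s₁ := Finset.range x.length)
    (Finset.range_mono (by simp [pairWord])) fun p _ hp => if_neg fun h => hp (Finset.mem_range.2 h)]
  rw [Finset.sum_congr rfl fun p hp => if_pos (Finset.mem_range.1 hp)]
  simp

theorem inputTokens_pairWord (x : List Sym) (c : List Bool) :
    inputTokens (pairWord (x, c)) = Tokens.ofList (toks x) := by
  rw [inputTokens, syms_pairWord, inputLength_pairWord, ofWord_spells x le_rfl]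

theorem exists_certificate (x : List Sym) (J T : ℕ) (F : ℕ → ℕ) (hF : ∀ j < J, F j ≤ T) :
    ∃ c : List Bool, c.length = J * T ∧ ∀ j < J, entry T (pairWord (x, c)) j = F j := by
  classical
  -- Digit `r` of block `j` is set exactly for `r < F j`.
  refine ⟨(List.range (J * T)).map fun i => decide (i % T < F (i / T)), by simp, fun j hj => ?_⟩
  rw [entry, inputLength_pairWord]
  have h : ∀ r ∈ Finset.range T, (if (pairWord (x, (List.range (J * T)).map fun i =>
      decide (i % T < F (i / T))))[x.length + (j * T + r)]? = some (.inr true) then 1 else 0) =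
      if r < F j then 1 else 0 := by
    intro r hr
    rw [Finset.mem_range] at hr
    have hlt : j * T + r < J * T := by
      have := Nat.mul_le_mul_right T (Nat.succ_le_of_lt hj)
      rw [Nat.succ_mul] at this
      omega
    refine if_congr ?_ rfl rfl
    rw [pairWord, List.getElem?_append_right (by simp)]
    simp only [List.length_map, Nat.add_sub_cancel_left, List.map_map, List.getElem?_map]
    rw [List.getElem?_range hlt]
    have hT : 0 < T := by omega
    rw [Nat.mul_comm]
    simp [Nat.mul_add_div hT, Nat.mod_eq_of_lt hr, Nat.div_eq_of_lt hr]
  rw [Finset.sum_congr rfl h, ← Finset.sum_subset (s₁ := Finset.range (F j))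
    (Finset.range_mono (hF j hj)) fun p _ hp => if_neg fun h => hp (Finset.mem_range.2 h),
    Finset.sum_congr rfl fun p hp => if_pos (Finset.mem_range.1 hp)]
  simp

theorem index_lt {M n s a b : ℕ} (hs : s < M) (ha : a < n) (hb : b ≤ n) :
    (s * n + a) * (n + 1) + b < M * n * (n + 1) := by
  have h1 : s * n + a + 1 ≤ M * n := by
    have := Nat.mul_le_mul_right n (Nat.succ_le_of_lt hs)
    rw [Nat.succ_mul] at this
    omega
  have := Nat.mul_le_mul_right (n + 1) h1
  rw [Nat.succ_mul] at this
  omega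

theorem length_toks_le (x : List Sym) : (toks x).length ≤ x.length := by
  classical
  rw [← cnt_length, cnt]
  refine (Finset.sum_le_card_nsmul _ _ 1 fun i _ => ?_).trans (by simp)
  split_ifs <;> simp

theorem exists_check_of_refut {k : ℕ} {x : List Sym} {sig : ℕ → ℕ → ℕ} {rk : ℕ → ℕ → ℕ → ℕ}
    (h : (Tokens.ofList (toks x)).Refut (numCtx k x.length) sig rk)
    (hrk : ∀ s a b, rk s a b ≤ numCtx k x.length * (x.length * x.length)) :
    ∃ c : List Bool, c.length = numCtx k x.length * x.length * (x.length + 1) *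
      maxEntry k x.length ∧ Check k (pairWord (x, c)) := by
  set n := x.length with hn
  set T := maxEntry k n with hT
  have hm : (Tokens.ofList (toks x)).m ≤ n := length_toks_le x
  obtain ⟨c, hc, hF⟩ := exists_certificate x (numCtx k n * n * (n + 1)) T
    -- Division and remainder recover context, token and column from the index. The minimum enforces
    -- the bound at all indices and changes nothing at those that are read.
    (fun j => min T (if j % (n + 1) = n then sig (j / (n + 1) / n) (j / (n + 1) % n) else
      rk (j / (n + 1) / n) (j / (n + 1) % n) (j % (n + 1)))) fun _ _ => min_le_left _ _
  refine ⟨c, hc, .inr ?_⟩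
  rw [inputTokens_pairWord, inputLength_pairWord, ← hn, ← hT]
  have key : ∀ s < numCtx k n, ∀ a < n, ∀ b ≤ n,
      entry T (pairWord (x, c)) ((s * n + a) * (n + 1) + b) =
        min T (if b = n then sig s a else rk s a b) := by
    intro s hs a ha b hb
    have hn0 : 0 < n := by omega
    have e1 : ((s * n + a) * (n + 1) + b) / (n + 1) = s * n + a := by
      rw [Nat.mul_comm _ (n + 1), Nat.mul_add_div (Nat.succ_pos n),
        Nat.div_eq_of_lt (Nat.lt_succ_of_le hb), Nat.add_zero]
    have e2 : ((s * n + a) * (n + 1) + b) % (n + 1) = b := by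
      rw [Nat.mul_comm _ (n + 1), Nat.mul_add_mod, Nat.mod_eq_of_lt (Nat.lt_succ_of_le hb)]
    have e3 : (s * n + a) / n = s := by
      rw [Nat.mul_comm s n, Nat.mul_add_div hn0, Nat.div_eq_of_lt ha, Nat.add_zero]
    have e4 : (s * n + a) % n = a := by
      rw [Nat.mul_comm s n, Nat.mul_add_mod, Nat.mod_eq_of_lt ha]
    rw [hF _ (index_lt hs ha hb)]
    simp only [e1, e2, e3, e4]
  refine h.congr (fun s hs i hi => ?_) fun s hs a ha b hb => ?_
  · rw [key s hs i (hi.trans_le hm) n le_rfl, if_pos rfl, min_eq_right]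
    have := h.1 s hs i hi
    rw [hT, maxEntry]
    omega
  · have hb' : b < n := hb.trans_le hm
    rw [key s hs a (ha.trans_le hm) b hb'.le, if_neg hb'.ne, min_eq_right]
    have := hrk s a b
    rw [hT, maxEntry]
    omega

theorem bits_eq_nil_iff (x : List Sym) :
    bits x = [] ↔ ¬ (Spells x 0 (.bit false) ∨ Spells x 0 (.bit true)) := by
  rcases x with _ | ⟨_ | _ | _ | _ | _ | _ | _, x⟩ <;> simp [bits, Spells]

/-- The words that are not true sentences are those with a certificate. -/
theorem not_mem_sigmaQCSP_iff (k : ℕ) (x : List Sym) : x ∉ sigmaQCSP (2 * k + 1) ↔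
    ∃ c : List Bool, c.length ≤ numCtx k x.length * x.length * (x.length + 1) *
      maxEntry k x.length ∧ Check k (pairWord (x, c)) := by
  by_cases hx : bits x = [] ∧ (Tokens.ofList (toks x)).WellFormed k
  · obtain ⟨φ, h1, h2, rfl⟩ := exists_sentence_iff.2 hx
    have htoks := (toks_encode φ).1
    have hr := Tokens.represents_toks h1
    constructor
    · intro hφ
      have hf : ¬ Holds φ.matrix φ.quants fun _ => 0 := fun h => hφ ⟨φ, h1, h2, h, rfl⟩
      have hwf := hx.2
      rw [htoks] at hwf
      obtain ⟨sig, rk, h, hrk⟩ := Tokens.exists_refut (k := k) (n := φ.encode.length)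
        (fun a ha => (Tokens.lev_mono ((Tokens.lt_of_isQuant ha).le.trans
          (Tokens.length_le_toks φ))).trans hwf.2.2.2)
        (fun a ha => Tokens.lt_of_S ha) (htoks ▸ length_toks_le φ.encode)
        (hr.exists_contradiction hf)
      obtain ⟨c, hc, hcheck⟩ := exists_check_of_refut (k := k) (x := φ.encode) (htoks ▸ h) hrk
      exact ⟨c, hc.le, hcheck⟩
    -- A true sentence `ψ` with the same encoding need not be `φ`, but it has the tokens that the
    -- certificate refutes.
    · rintro ⟨c, -, hc⟩ ⟨ψ, hψ, -, htrue, he⟩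
      rcases hc with hc | hc
      · rw [syms_pairWord, inputTokens_pairWord, ← bits_eq_nil_iff] at hc
        exact hc hx
      · rw [inputTokens_pairWord, ← he, (toks_encode ψ).1] at hc
        exact (Tokens.represents_toks hψ).not_holds hc _ htrue
  · refine iff_of_true (fun ⟨φ, h1, h2, _, he⟩ => hx (exists_sentence_iff.1 ⟨φ, h1, h2, he⟩))
      ⟨[], Nat.zero_le _, .inl ?_⟩
    rwa [syms_pairWord, inputTokens_pairWord, ← bits_eq_nil_iff]

theorem inCoNP_sigmaQCSP (k : ℕ) : InCoNP (sigmaQCSP (2 * k + 1)) := by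
  classical
  refine inNP_of_bsum _ (bp_check k).bsum
    ((1 + .X * .X) ^ (k + 1) * .X * (.X + 1) *
      ((1 + .X * .X) ^ (k + 1) * (.X * .X) + .X)) fun x => ?_
  refine (not_mem_sigmaQCSP_iff k x).trans (exists_congr fun c => and_congr ?_ ?_)
  · simp [numCtx, maxEntry]
  · simp

end EqQCSP

theorem mainTheorem4 (k : ℕ) : EqQCSP.InCoNP (EqQCSP.sigmaQCSP (2 * k + 1)) :=
  EqQCSP.inCoNP_sigmaQCSP k
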